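/- Let $V$ be a vector space of finite dimension $n$ over a field of characteristic $\neq 2$, let $\xi$ be a nondegenerate symplectic (alternating) bilinear form on $V$, and let $1\le k\le n-1$. For a subspace $U$ put $U^\perp=\{v\in V:\xi(u,v)=0\text{ for all }u\in U\}$ and $\mathrm{Rad}(U)=U\cap U^\perp$. Let $(\mathbf{T\text{-}R})_j$ be the set of $j$-dimensional subspaces $U$ with $\mathrm{Rad}(U)=0$ if $j$ is even, and with $\dim\mathrm{Rad}(U)=1$ if $j$ is odd. The Grassmann space $\mathbf{P}((\mathbf{T\text{-}R}),k)$ has $(\mathbf{T\text{-}R})_k$ as its set of points, and its lines are the nonempty sets of the form $\{U\in(\mathbf{T\text{-}R})_k: H\subset U\subset B\}$ with $H\in(\mathbf{T\text{-}R})_{k-1}$, $B\in(\mathbf{T\text{-}R})_{k+1}$, $H\subset B$. Write $U\sim W$ (adjacency) if $U\ne W$ lie on a common line of this space. Let $\mathfrak P$ be the projective space whose points and lines are the $1$- and $2$-dimensional subspaces of $V$, with inclusion as incidence. A collineation of $\mathfrak P$ is an automorphism of this incidence structure; it preserves $\perp$ (is an automorphism of $(\mathfrak P,\perp)$) if points $p,q$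 satisfy $\xi(p,q)=0$ exactly when their images do. A bijection $f$ of $(\mathbf{T\text{-}R})_k$ is induced by a collineation $\varphi$ if for each $U\in(\mathbf{T\text{-}R})_k$ the points of $f(U)$ are exactly the $\varphi$-images of the points of $U$. (1) If $k\ne n-k$, then every collineation of $\mathfrak P$ preserving $\perp$ induces exactly one bijection of $(\mathbf{T\text{-}R})_k$, and the following three classes of bijections of $(\mathbf{T\text{-}R})_k$ coincide: the automorphisms of $\mathbf{P}((\mathbf{T\text{-}R}),k)$; the bijections preserving $\sim$ in both directions; the bijections induced by collineations of $\mathfrak P$ preserving $\perp$. (2) If $k=n-k$, then every bijection of $(\mathbf{T\text{-}R})_k$ which preserves $\sim$ in both directions is either induced by an automorphism $\varphi$ of $(\mathfrak P,\perp)$, or is the composition of the duality $U\mapsto U^\perp$ and the map induced by an automorphism $\varphi$ of $(\mathfrak P,\perp)$, i.e. $U\mapsto\varphi(U^\perp)$. -/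

import Mathlib

namespace SymplecticGrassmann

section Subspaces

variable {F V : Type*} [Field F] [AddCommGroup V] [Module F V]

/-- `Rad U = U ∩ U^⊥`, where `U^⊥ = {v | ξ u v = 0 for all u ∈ U}`. -/
def rad (ξ : LinearMap.BilinForm F V) (U : Submodule F V) : Submodule F V :=
  U ⊓ ξ.orthogonal U

/-- Regular subspaces: those with zero radical. -/
def IsRegular (ξ : LinearMap.BilinForm F V) (U : Submodule F V) : Prop :=
  rad ξ U = ⊥

/-- Tangential subspaces: those whose radical is a projective point. -/
def IsTangential (ξ : LinearMap.BilinForm F V) (U : Submodule F V) : Prop :=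
  Module.finrank F (rad ξ U) = 1

/-- Membership in `(T-R)_k`: `U` is `k`-dimensional, and it is regular when `k` is even and
tangential when `k` is odd. -/
def IsTR (ξ : LinearMap.BilinForm F V) (k : ℕ) (U : Submodule F V) : Prop :=
  Module.finrank F U = k ∧ (Even k → IsRegular ξ U) ∧ (¬ Even k → IsTangential ξ U)

/-- The set `(T-R)_k`, as a type. -/
abbrev TR (ξ : LinearMap.BilinForm F V) (k : ℕ) : Type _ :=
  {U : Submodule F V // IsTR ξ k U}

/-- The `(T-R)`-pencil `p(H, B)` of all `U` in `(T-R)_k` with `H ⊆ U ⊆ B`. -/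
def pencil (ξ : LinearMap.BilinForm F V) (k : ℕ) (H B : Submodule F V) : Set (TR ξ k) :=
  {U | H ≤ U.1 ∧ U.1 ≤ B}

/-- The lines of the Grassmann space on `(T-R)_k` (used for `1 ≤ k ≤ n - 1`): the nonempty
pencils `p(H, B)` with `H ∈ (T-R)_{k-1}`, `B ∈ (T-R)_{k+1}`, `H ⊆ B`. -/
def pencils (ξ : LinearMap.BilinForm F V) (k : ℕ) : Set (Set (TR ξ k)) :=
  {g | g.Nonempty ∧ ∃ H B : Submodule F V,
    IsTR ξ (k - 1) H ∧ IsTR ξ (k + 1) B ∧ H ≤ B ∧ g = pencil ξ k H B}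

/-- Adjacency on `(T-R)_k`: being distinct and on a common line of the Grassmann space. -/
def Adj (ξ : LinearMap.BilinForm F V) (k : ℕ) (U W : TR ξ k) : Prop :=
  U ≠ W ∧ ∃ g ∈ pencils ξ k, U ∈ g ∧ W ∈ g

/-- The automorphisms of the Grassmann space `⟨(T-R)_k, pencils⟩`: the bijections of the points
under which a set of points is a line if and only if its image is a line. -/
def grassmannAutomorphisms (ξ : LinearMap.BilinForm F V) (k : ℕ) : Set (Equiv.Perm (TR ξ k)) :=
  {f | ∀ g : Set (TR ξ k), f '' g ∈ pencils ξ k ↔ g ∈ pencils ξ k}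

/-- The bijections of `(T-R)_k` which preserve the adjacency in both directions. -/
def adjacencyBijections (ξ : LinearMap.BilinForm F V) (k : ℕ) : Set (Equiv.Perm (TR ξ k)) :=
  {f | ∀ U W : TR ξ k, Adj ξ k (f U) (f W) ↔ Adj ξ k U W}

end Subspaces

section Collineations

variable (F V : Type*) [Field F] [AddCommGroup V] [Module F V]

/-- The set `Sub_j(V)` of the `j`-dimensional subspaces, as a type. -/
abbrev Sub (j : ℕ) : Type _ := {U : Submodule F V // Module.finrank F U = j}

/-- A collineation of the projective space `⟨Sub_1(V), Sub_2(V), ⊂⟩`, i.e. an automorphism of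
this incidence structure. -/
structure Collineation where
  onPoints : Equiv.Perm (Sub F V 1)
  onLines : Equiv.Perm (Sub F V 2)
  incidence : ∀ (p : Sub F V 1) (L : Sub F V 2),
    (onPoints p).1 ≤ (onLines L).1 ↔ p.1 ≤ L.1

variable {F V}

/-- The conjugacy: `ξ(U, W) = 0`. -/
def Conj (ξ : LinearMap.BilinForm F V) (U W : Submodule F V) : Prop :=
  ∀ u ∈ U, ∀ w ∈ W, ξ u w = 0

/-- The collineation preserves the conjugacy, i.e. is an automorphism of `(P, ⊥)`. -/
def Collineation.PreservesConj (ξ : LinearMap.BilinForm F V) (φ : Collineation F V) : Prop :=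
  ∀ p q : Sub F V 1, Conj ξ (φ.onPoints p).1 (φ.onPoints q).1 ↔ Conj ξ p.1 q.1

/-- `φ` takes the subspace `U` to the subspace `W`: the points of `W` are exactly the images of
the points of `U`. A subspace is determined by its points, so there is at most one such `W`. -/
def Collineation.Maps (φ : Collineation F V) (U W : Submodule F V) : Prop :=
  ∀ p : Sub F V 1, (φ.onPoints p).1 ≤ W ↔ p.1 ≤ U

/-- The bijections of `(T-R)_k` of the form `U ↦ φ(U)`, with `φ` a collineation preserving the
conjugacy. -/
def inducedBijections (ξ : LinearMap.BilinForm F V) (k : ℕ) : Set (Equiv.Perm (TR ξ k)) :=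
  {f | ∃ φ : Collineation F V, φ.PreservesConj ξ ∧ ∀ U : TR ξ k, φ.Maps U.1 (f U).1}

/-- The bijections of `(T-R)_k` of the form `U ↦ φ(U^⊥)`, with `φ` a collineation preserving the
conjugacy. -/
def dualInducedBijections (ξ : LinearMap.BilinForm F V) (k : ℕ) : Set (Equiv.Perm (TR ξ k)) :=
  {f | ∃ φ : Collineation F V, φ.PreservesConj ξ ∧
    ∀ U : TR ξ k, φ.Maps (ξ.orthogonal U.1) (f U).1}

end Collineations

end SymplecticGrassmann

open SymplecticGrassmann

/-! Adjacency alone has to recover the lattice of subspaces together with `⊥`. For `k = 1` it does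
so at once: two points are adjacent iff they are not orthogonal, and since every subspace is its own
double orthogonal, a permutation of the points preserving orthogonality both ways extends to a
lattice automorphism commuting with `⊥` (`exists_orderIso_of_conj`). The case `k = n - 1` is dual.
Every other level is brought down to points one dimension at a time.

The descent requires stars (all members over a fixed `H`) and tops (all members below a fixed `B`)
to be visible in the graph. At odd levels they need not be cliques of adjacency, because meets and
joins may have the wrong radical. The coarser relation `Near` repairs this; it is definable from
adjacency by a four-vertex configuration (`near_iff`, where characteristic `≠ 2` enters). Away from
the extreme levels, the maximal `Near`-cliques containing an adjacent pair are exactly the stars and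
the tops (`isBlock_star`, `isBlock_top`, `IsBlock.eq_star_or_eq_top`). Connectivity of the geometry
then leaves two options: stars go to stars, or tops go to stars (`mapsStars_or_image_top`).

If the two kinds are preserved, the action on stars is a bijection one level lower that respects
incidence. It preserves adjacency there because adjacency is expressible by incidence with the next
level (`adj_map_iff_of_incidence`), and induction reaches the points. If the kinds are swapped,
composing with `U ↦ Uᗮ` gives a tops-preserving isomorphism from level `k` to level `n - k`; the
same descent forces `k = n - k`, since points cannot be matched with an intermediate level
(`eq_zero_of_adj_one`). -/

namespace SymplecticGrassmann

open Module Submodule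

/-! ### Orthogonality and radicals for a symplectic form -/

section Perp

variable {F V : Type*} [Field F] [AddCommGroup V] [Module F V] {ξ : LinearMap.BilinForm F V}

theorem le_orthogonal_comm (halt : ξ.IsAlt) {A B : Submodule F V} :
    A ≤ ξ.orthogonal B ↔ B ≤ ξ.orthogonal A :=
  ⟨fun h b hb _ ha => halt.isRefl _ _ (h ha b hb), fun h a ha _ hb => halt.isRefl _ _ (h hb a ha)⟩

theorem orthogonal_sup (A B : Submodule F V) :
    ξ.orthogonal (A ⊔ B) = ξ.orthogonal A ⊓ ξ.orthogonal B := by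
  apply le_antisymm
  · exact le_inf (LinearMap.BilinForm.orthogonal_le le_sup_left)
      (LinearMap.BilinForm.orthogonal_le le_sup_right)
  · intro x hx y hy
    obtain ⟨a, ha, b, hb, rfl⟩ := mem_sup.1 hy
    simp [hx.1 a ha, hx.2 b hb]

theorem mem_orthogonal_span_singleton {x y : V} :
    y ∈ ξ.orthogonal (span F {x}) ↔ ξ x y = 0 := by
  refine ⟨fun h => h x (mem_span_singleton_self x), fun h z hz => ?_⟩
  obtain ⟨c, rfl⟩ := mem_span_singleton.1 hz
  simp [h]

theorem mem_rad {U : Submodule F V} {x : V} :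
    x ∈ rad ξ U ↔ x ∈ U ∧ ∀ u ∈ U, ξ u x = 0 := Iff.rfl

theorem isRegular_iff {U : Submodule F V} :
    IsRegular ξ U ↔ ∀ x ∈ U, (∀ u ∈ U, ξ u x = 0) → x = 0 := by
  rw [IsRegular, eq_bot_iff]
  exact ⟨fun h x hx hu => (mem_bot F).1 (h (mem_rad.2 ⟨hx, hu⟩)),
    fun h x hx => (mem_bot F).2 (h x hx.1 hx.2)⟩

theorem mem_sup_span_singleton {H : Submodule F V} {x z : V} :
    z ∈ H ⊔ span F {x} ↔ ∃ h ∈ H, ∃ c : F, z = h + c • x := by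
  simp only [mem_sup, mem_span_singleton]
  constructor
  · rintro ⟨h, hh, _, ⟨c, rfl⟩, rfl⟩; exact ⟨h, hh, c, rfl⟩
  · rintro ⟨h, hh, c, rfl⟩; exact ⟨h, hh, _, ⟨c, rfl⟩, rfl⟩

theorem IsRegular.notMem {H : Submodule F V} (hH : IsRegular ξ H) {y : V}
    (hy : y ∈ ξ.orthogonal H) (h0 : y ≠ 0) : y ∉ H :=
  fun h => h0 (isRegular_iff.1 hH y h hy)

/-- Adding a hyperbolic line of `H^⊥` to a regular `H` gives a regular subspace. -/
theorem IsRegular.sup_sup (halt : ξ.IsAlt) {H : Submodule F V}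
    (hH : IsRegular ξ H) {y z : V} (hy : y ∈ ξ.orthogonal H) (hz : z ∈ ξ.orthogonal H)
    (hyz : ξ y z ≠ 0) : IsRegular ξ (H ⊔ span F {y} ⊔ span F {z}) := by
  rw [isRegular_iff] at hH ⊢
  intro x hx hu
  obtain ⟨w, hw, c, rfl⟩ := mem_sup_span_singleton.1 hx
  obtain ⟨h, hh, b, rfl⟩ := mem_sup_span_singleton.1 hw
  have hHle : H ≤ H ⊔ span F {y} ⊔ span F {z} := le_sup_left.trans le_sup_left
  have e1 := hu y (mem_sup_left (mem_sup_right (mem_span_singleton_self y)))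
  have e2 := hu z (mem_sup_right (mem_span_singleton_self z))
  have hyh : ξ y h = 0 := halt.isRefl _ _ (hy h hh)
  have hzh : ξ z h = 0 := halt.isRefl _ _ (hz h hh)
  have hzy : ξ z y ≠ 0 := fun e => hyz (halt.isRefl _ _ e)
  simp only [map_add, map_smul, hyh, halt y, smul_eq_mul, mul_zero, zero_add, mul_eq_zero, hyz,
    or_false] at e1
  simp only [map_add, map_smul, hzh, halt z, smul_eq_mul, mul_zero, zero_add, add_zero,
    mul_eq_zero, hzy, or_false] at e2
  subst e1; subst e2
  simp only [zero_smul, add_zero] at hu ⊢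
  exact hH h hh fun u hu' => hu u (hHle hu')

variable [FiniteDimensional F V]

theorem finrank_add_finrank_orthogonal_eq (hnd : ξ.Nondegenerate) (U : Submodule F V) :
    finrank F U + finrank F (ξ.orthogonal U) = finrank F V := by
  rw [LinearMap.BilinForm.finrank_orthogonal hnd]
  have := U.finrank_le
  omega

theorem orthogonal_orthogonal_eq (halt : ξ.IsAlt) (hnd : ξ.Nondegenerate) (U : Submodule F V) :
    ξ.orthogonal (ξ.orthogonal U) = U :=
  LinearMap.BilinForm.orthogonal_orthogonal hnd halt.isRefl U

theorem orthogonal_le_orthogonal_iff (halt : ξ.IsAlt) (hnd : ξ.Nondegenerate)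
    {A B : Submodule F V} : ξ.orthogonal A ≤ ξ.orthogonal B ↔ B ≤ A := by
  rw [le_orthogonal_comm halt, orthogonal_orthogonal_eq halt hnd]

theorem orthogonal_inf (halt : ξ.IsAlt) (hnd : ξ.Nondegenerate) (A B : Submodule F V) :
    ξ.orthogonal (A ⊓ B) = ξ.orthogonal A ⊔ ξ.orthogonal B := by
  rw [← orthogonal_orthogonal_eq halt hnd (ξ.orthogonal A ⊔ ξ.orthogonal B), orthogonal_sup,
    orthogonal_orthogonal_eq halt hnd, orthogonal_orthogonal_eq halt hnd]

theorem rad_orthogonal (halt : ξ.IsAlt) (hnd : ξ.Nondegenerate) (U : Submodule F V) :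
    rad ξ (ξ.orthogonal U) = rad ξ U := by
  rw [rad, rad, orthogonal_orthogonal_eq halt hnd, inf_comm]

theorem isRegular_orthogonal (halt : ξ.IsAlt) (hnd : ξ.Nondegenerate) {U : Submodule F V} :
    IsRegular ξ (ξ.orthogonal U) ↔ IsRegular ξ U := by
  rw [IsRegular, IsRegular, rad_orthogonal halt hnd]

theorem isTangential_orthogonal (halt : ξ.IsAlt) (hnd : ξ.Nondegenerate) {U : Submodule F V} :
    IsTangential ξ (ξ.orthogonal U) ↔ IsTangential ξ U := by
  rw [IsTangential, IsTangential, rad_orthogonal halt hnd]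

/-- A regular subspace splits the space. -/
theorem IsRegular.exists_add (hnd : ξ.Nondegenerate) {H : Submodule F V} (hH : IsRegular ξ H)
    (v : V) : ∃ h ∈ H, ∃ d ∈ ξ.orthogonal H, v = h + d := by
  have h1 := finrank_add_finrank_orthogonal_eq hnd H
  have h2 := finrank_sup_add_finrank_inf_eq H (ξ.orthogonal H)
  have h3 : H ⊓ ξ.orthogonal H = ⊥ := hH
  rw [h3, finrank_bot] at h2
  have h4 : H ⊔ ξ.orthogonal H = ⊤ := eq_top_of_finrank_eq (by omega)
  obtain ⟨h, hh, d, hd, e⟩ := mem_sup.1 (h4 ▸ mem_top : v ∈ H ⊔ ξ.orthogonal H)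
  exact ⟨h, hh, d, hd, e.symm⟩

/-- Since `U` splits off, `B` is the direct sum of `U` and the line `B ⊓ Uᗮ`. The form is
alternating, so this line is orthogonal to itself and is therefore the radical of `B`. -/
theorem IsRegular.isTangential_of_le (halt : ξ.IsAlt) (hnd : ξ.Nondegenerate)
    {U B : Submodule F V} (hU : IsRegular ξ U) (hUB : U ≤ B) (hB : finrank F B = finrank F U + 1) :
    IsTangential ξ B := by
  have h1 := finrank_add_finrank_orthogonal_eq hnd U
  have h2 := finrank_sup_add_finrank_inf_eq B (ξ.orthogonal U)
  have h3 := (B ⊔ ξ.orthogonal U).finrank_le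
  have h4 := finrank_sup_add_finrank_inf_eq U (B ⊓ ξ.orthogonal U)
  have h5 : U ⊓ (B ⊓ ξ.orthogonal U) = ⊥ := by
    rw [inf_left_comm, show U ⊓ ξ.orthogonal U = ⊥ from hU, inf_bot_eq]
  rw [h5, finrank_bot] at h4
  have h6 : U ⊔ (B ⊓ ξ.orthogonal U) ≤ B := sup_le hUB inf_le_left
  have h7 := finrank_mono h6
  have h8 : finrank F ↥(B ⊓ ξ.orthogonal U) = 1 := by omega
  have h9 : U ⊔ (B ⊓ ξ.orthogonal U) = B := eq_of_le_of_finrank_eq h6 (by omega)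
  have h10 : rad ξ B = B ⊓ ξ.orthogonal U := by
    apply le_antisymm (inf_le_inf_left _ (LinearMap.BilinForm.orthogonal_le hUB))
    refine le_inf inf_le_left ?_
    rw [← h9, orthogonal_sup, h9]
    refine le_inf inf_le_right fun x hx y hy => ?_
    by_cases hy0 : y = 0
    · simp [hy0]
    · obtain ⟨c, hc⟩ := (finrank_eq_one_iff_of_nonzero' (⟨y, hy⟩ : ↥(B ⊓ ξ.orthogonal U))
        (by simpa using hy0)).1 h8 ⟨x, hx⟩
      have : x = c • y := (congrArg Subtype.val hc).symm
      rw [this]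
      simp [halt y]
  rw [IsTangential, h10, h8]

theorem IsRegular.isTangential_of_ge (halt : ξ.IsAlt) (hnd : ξ.Nondegenerate)
    {H U : Submodule F V} (hU : IsRegular ξ U) (hHU : H ≤ U) (hH : finrank F H + 1 = finrank F U) :
    IsTangential ξ H := by
  rw [← isTangential_orthogonal halt hnd]
  rw [← isRegular_orthogonal halt hnd] at hU
  refine hU.isTangential_of_le halt hnd (LinearMap.BilinForm.orthogonal_le hHU) ?_
  have h1 := finrank_add_finrank_orthogonal_eq hnd U
  have h2 := finrank_add_finrank_orthogonal_eq hnd H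
  omega

theorem IsRegular.finrank_sup_sup {H : Submodule F V} (halt : ξ.IsAlt)
    (hH : IsRegular ξ H) {y z : V} (hy : y ∈ ξ.orthogonal H) (hz : z ∈ ξ.orthogonal H)
    (hyz : ξ y z ≠ 0) : finrank F ↥(H ⊔ span F {y} ⊔ span F {z}) = finrank F H + 2 := by
  have hy0 : y ≠ 0 := by rintro rfl; simp at hyz
  rw [finrank_sup_span_singleton, finrank_sup_span_singleton (hH.notMem hy hy0)]
  intro hmem
  obtain ⟨h, hh, c, rfl⟩ := mem_sup_span_singleton.1 hmem
  have : ξ y h = 0 := halt.isRefl _ _ (hy h hh)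
  simp [this, halt y] at hyz

/-- In the orthogonal complement of a regular subspace, no nonzero vector is isolated. -/
theorem IsRegular.exists_orthogonal_ne (halt : ξ.IsAlt) (hnd : ξ.Nondegenerate)
    {H : Submodule F V} (hH : IsRegular ξ H) {y : V} (hy : y ∈ ξ.orthogonal H) (h0 : y ≠ 0) :
    ∃ z ∈ ξ.orthogonal H, ξ y z ≠ 0 := by
  rw [← isRegular_orthogonal halt hnd, isRegular_iff] at hH
  by_contra! hc
  exact h0 (hH y hy fun u hu => halt.isRefl _ _ (hc u hu))

theorem even_finrank (halt : ξ.IsAlt) (hnd : ξ.Nondegenerate) : Even (finrank F V) := by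
  -- Hyperbolic planes are split off successively. The bound `finrank F V + 1` lets the construction
  -- overshoot: in odd dimension it would produce a subspace larger than `V`.
  have key : ∀ j : ℕ, 2 * j ≤ finrank F V + 1 →
      ∃ H : Submodule F V, finrank F H = 2 * j ∧ IsRegular ξ H := by
    intro j
    induction j with
    | zero => exact fun _ => ⟨⊥, by simp, by simp [IsRegular, rad]⟩
    | succ j ih =>
      intro hj
      obtain ⟨H, hd, hH⟩ := ih (by omega)
      have h1 := finrank_add_finrank_orthogonal_eq hnd H
      obtain ⟨y, hy, h0⟩ := exists_mem_ne_zero_of_ne_bot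
        (fun h : ξ.orthogonal H = ⊥ => by rw [h, finrank_bot] at h1; omega)
      obtain ⟨z, hz, hyz⟩ := hH.exists_orthogonal_ne halt hnd hy h0
      exact ⟨_, by rw [hH.finrank_sup_sup halt hy hz hyz]; omega, hH.sup_sup halt hy hz hyz⟩
  by_contra hodd
  rw [Nat.not_even_iff_odd] at hodd
  obtain ⟨j, hj⟩ := hodd
  obtain ⟨H, hd, -⟩ := key (j + 1) (by omega)
  have := H.finrank_le
  omega

end Perp

/-! ### Dimension arguments with hyperplanes -/

section Hyperplanes

variable {F V : Type*} [Field F] [AddCommGroup V] [Module F V]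

/-- A vector space is not the union of two proper subspaces. -/
theorem exists_mem_notMem_notMem {B Z W : Submodule F V} (hZ : ¬ B ≤ Z) (hW : ¬ B ≤ W) :
    ∃ x ∈ B, x ∉ Z ∧ x ∉ W := by
  obtain ⟨a, ha, haZ⟩ := SetLike.not_le_iff_exists.1 hZ
  obtain ⟨b, hb, hbW⟩ := SetLike.not_le_iff_exists.1 hW
  by_cases haW : a ∈ W
  · by_cases hbZ : b ∈ Z
    · exact ⟨a + b, add_mem ha hb, fun h => haZ ((Z.add_mem_iff_left hbZ).1 h),
        fun h => hbW ((W.add_mem_iff_right haW).1 h)⟩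
    · exact ⟨b, hb, hbZ, hbW⟩
  · exact ⟨a, ha, haZ, haW⟩

variable [FiniteDimensional F V]

theorem sup_eq_of_finrank {A B X : Submodule F V} (hA : A ≤ X) (hB : B ≤ X)
    (hAX : finrank F A + 1 = finrank F X) (hAB : finrank F A = finrank F B) (hne : A ≠ B) :
    A ⊔ B = X := by
  refine eq_of_le_of_finrank_le (sup_le hA hB) ?_
  have h : A < A ⊔ B := by
    refine lt_of_le_of_ne le_sup_left fun h => hne ?_
    exact (eq_of_le_of_finrank_eq (le_sup_right.trans h.ge) hAB.symm).symm
  have := finrank_lt_finrank_of_lt h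
  omega

theorem inf_eq_of_finrank {A X Y : Submodule F V} (hX : A ≤ X) (hY : A ≤ Y)
    (hAX : finrank F A + 1 = finrank F X) (hXY : finrank F X = finrank F Y) (hne : X ≠ Y) :
    X ⊓ Y = A := by
  symm
  refine eq_of_le_of_finrank_le (le_inf hX hY) ?_
  have h : X ⊓ Y < X := by
    refine lt_of_le_of_ne inf_le_left fun h => hne ?_
    exact eq_of_le_of_finrank_eq (h.ge.trans inf_le_right) hXY
  have := finrank_lt_finrank_of_lt h
  omega

end Hyperplanes

end SymplecticGrassmann

namespace SymplecticGrassmann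

open Module Submodule

set_option linter.unusedSectionVars false

variable {F V : Type*} [Field F] [AddCommGroup V] [Module F V] {ξ : LinearMap.BilinForm F V}
  [FiniteDimensional F V] {m m' : ℕ}

/-! ### The sets (T-R), duality and adjacency -/

section TR

theorem IsTR.succ_of_le (halt : ξ.IsAlt) (hnd : ξ.Nondegenerate) (hm : Even m)
    {U B : Submodule F V} (hU : IsTR ξ m U) (hUB : U ≤ B) (hB : finrank F B = m + 1) :
    IsTR ξ (m + 1) B :=
  ⟨hB, fun h => absurd hm (by simpa [parity_simps] using h),
    fun _ => (hU.2.1 hm).isTangential_of_le halt hnd hUB (by rw [hB, hU.1])⟩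

theorem IsTR.of_succ_of_ge (halt : ξ.IsAlt) (hnd : ξ.Nondegenerate) (hm : Even (m + 1))
    {H U : Submodule F V} (hU : IsTR ξ (m + 1) U) (hHU : H ≤ U) (hH : finrank F H = m) :
    IsTR ξ m H :=
  ⟨hH, fun h => absurd h (by simpa [parity_simps] using hm),
    fun _ => (hU.2.1 hm).isTangential_of_ge halt hnd hHU (by rw [hH, hU.1])⟩

/-- The radical is unchanged by `⊥`, and `dim V` is even, so `m` and `m'` have the same parity and
the same type is demanded at both levels. -/
theorem isTR_orthogonal (halt : ξ.IsAlt) (hnd : ξ.Nondegenerate) (h : m + m' = finrank F V)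
    {U : Submodule F V} : IsTR ξ m' (ξ.orthogonal U) ↔ IsTR ξ m U := by
  have h1 := finrank_add_finrank_orthogonal_eq hnd U
  have h2 : Even m ↔ Even m' := by
    have := even_finrank halt hnd
    rw [← h] at this
    exact Nat.even_add.1 this
  rw [IsTR, IsTR, isRegular_orthogonal halt hnd, isTangential_orthogonal halt hnd, h2]
  have h3 : finrank F (ξ.orthogonal U) = m' ↔ finrank F U = m := by omega
  rw [h3]

/-- The duality `U ↦ U^⊥`. -/
def orthogonalEquiv (halt : ξ.IsAlt) (hnd : ξ.Nondegenerate) (h : m + m' = finrank F V) :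
    TR ξ m ≃ TR ξ m' where
  toFun U := ⟨ξ.orthogonal U.1, (isTR_orthogonal halt hnd h).2 U.2⟩
  invFun U := ⟨ξ.orthogonal U.1, (isTR_orthogonal halt hnd (by omega)).2 U.2⟩
  left_inv U := Subtype.ext (orthogonal_orthogonal_eq halt hnd U.1)
  right_inv U := Subtype.ext (orthogonal_orthogonal_eq halt hnd U.1)

theorem TR.finrank_eq {k : ℕ} (X : TR ξ k) : finrank F X.1 = k := X.2.1

theorem TR.eq_of_le {k : ℕ} {X Y : TR ξ k} (h : X.1 ≤ Y.1) : X = Y :=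
  Subtype.ext (eq_of_le_of_finrank_eq h (by rw [X.finrank_eq, Y.finrank_eq]))

theorem TR.finrank_inf_le {X Y : TR ξ (m + 1)} (h : X ≠ Y) : finrank F ↥(X.1 ⊓ Y.1) ≤ m := by
  have h1 : X.1 ⊓ Y.1 < X.1 :=
    lt_of_le_of_ne inf_le_left fun e => h (TR.eq_of_le (e.ge.trans inf_le_right))
  have := finrank_lt_finrank_of_lt h1
  rw [X.finrank_eq] at this
  omega

theorem TR.inf_eq {X Y : TR ξ (m + 1)} (h : X ≠ Y) {H : Submodule F V} (hH : finrank F H = m)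
    (hX : H ≤ X.1) (hY : H ≤ Y.1) : X.1 ⊓ Y.1 = H :=
  inf_eq_of_finrank hX hY (by rw [hH, X.finrank_eq]) (by rw [X.finrank_eq, Y.finrank_eq])
    fun e => h (Subtype.ext e)

theorem TR.sup_eq {X Y : TR ξ (m + 1)} (h : X ≠ Y) {B : Submodule F V} (hB : finrank F B = m + 2)
    (hX : X.1 ≤ B) (hY : Y.1 ≤ B) : X.1 ⊔ Y.1 = B :=
  sup_eq_of_finrank hX hY (by rw [hB, X.finrank_eq]) (by rw [X.finrank_eq, Y.finrank_eq])
    fun e => h (Subtype.ext e)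

theorem TR.finrank_sup_add (X Y : TR ξ (m + 1)) :
    finrank F ↥(X.1 ⊔ Y.1) + finrank F ↥(X.1 ⊓ Y.1) = 2 * m + 2 := by
  rw [finrank_sup_add_finrank_inf_eq, X.finrank_eq, Y.finrank_eq]
  omega

/-- By dimension, the only possible pencil through two distinct members is the one between their
meet and their join. -/
theorem adj_iff {X Y : TR ξ (m + 1)} :
    Adj ξ (m + 1) X Y ↔ X ≠ Y ∧ IsTR ξ m (X.1 ⊓ Y.1) ∧ IsTR ξ (m + 2) (X.1 ⊔ Y.1) := by
  constructor
  · rintro ⟨hne, g, ⟨-, H, B, hH, hB, -, rfl⟩, hX, hY⟩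
    refine ⟨hne, ?_, ?_⟩
    · rw [TR.inf_eq hne hH.1 hX.1 hY.1]; exact hH
    · rw [TR.sup_eq hne hB.1 hX.2 hY.2]; exact hB
  · rintro ⟨hne, hH, hB⟩
    exact ⟨hne, pencil ξ (m + 1) (X.1 ⊓ Y.1) (X.1 ⊔ Y.1),
      ⟨⟨X, inf_le_left, le_sup_left⟩, _, _, hH, hB, inf_le_left.trans le_sup_left, rfl⟩,
      ⟨inf_le_left, le_sup_left⟩, ⟨inf_le_right, le_sup_right⟩⟩

theorem adj_orthogonalEquiv (halt : ξ.IsAlt) (hnd : ξ.Nondegenerate)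
    (h : (m + 1) + (m' + 1) = finrank F V) {X Y : TR ξ (m + 1)} :
    Adj ξ (m' + 1) (orthogonalEquiv halt hnd h X) (orthogonalEquiv halt hnd h Y) ↔
      Adj ξ (m + 1) X Y := by
  rw [adj_iff, adj_iff, (orthogonalEquiv halt hnd h).injective.ne_iff]
  have e1 : (orthogonalEquiv halt hnd h X).1 ⊓ (orthogonalEquiv halt hnd h Y).1 =
      ξ.orthogonal (X.1 ⊔ Y.1) := (orthogonal_sup _ _).symm
  have e2 : (orthogonalEquiv halt hnd h X).1 ⊔ (orthogonalEquiv halt hnd h Y).1 =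
      ξ.orthogonal (X.1 ⊓ Y.1) := (orthogonal_inf halt hnd _ _).symm
  rw [e1, e2, isTR_orthogonal (m := m + 2) halt hnd (by omega),
    isTR_orthogonal (m := m) halt hnd (by omega), and_comm (a := IsTR ξ (m + 2) _)]

/-- At a regular level only dimensions matter: hyperplanes and one-dimensional extensions of a
regular space are automatically tangential. -/
theorem adj_of_even (halt : ξ.IsAlt) (hnd : ξ.Nondegenerate) (hm : Even (m + 1))
    {X Y : TR ξ (m + 1)} (hne : X ≠ Y) (h : finrank F ↥(X.1 ⊓ Y.1) = m) :
    Adj ξ (m + 1) X Y := by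
  have := X.finrank_sup_add Y
  exact adj_iff.2 ⟨hne, X.2.of_succ_of_ge halt hnd hm inf_le_left h,
    X.2.succ_of_le halt hnd hm le_sup_left (by omega)⟩

theorem IsTR.exists_span (hnd : ξ.Nondegenerate) (hm : Even m)
    {H : Submodule F V} (hH : IsTR ξ m H) {X : Submodule F V} (hX : finrank F X = m + 1)
    (hHX : H ≤ X) :
    ∃ y ∈ ξ.orthogonal H, y ≠ 0 ∧ X = H ⊔ span F {y} := by
  have hlt : ¬ X ≤ H := fun h => by have := finrank_mono h; rw [hH.1, hX] at this; omega
  obtain ⟨x, hx, hxH⟩ := SetLike.not_le_iff_exists.1 hlt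
  obtain ⟨h, hh, d, hd, rfl⟩ := (hH.2.1 hm).exists_add hnd x
  have hdH : d ∉ H := fun hd' => hxH (add_mem hh hd')
  refine ⟨d, hd, fun h0 => hdH (h0 ▸ zero_mem _), (eq_of_le_of_finrank_eq ?_ ?_).symm⟩
  · exact sup_le hHX ((span_singleton_le_iff_mem _ _).2 ((X.add_mem_iff_right (hHX hh)).1 hx))
  · rw [finrank_sup_span_singleton hdH, hH.1, hX]

theorem IsTR.sup_span (halt : ξ.IsAlt) (hnd : ξ.Nondegenerate) (hm : Even m)
    {H : Submodule F V} (hH : IsTR ξ m H) {y : V} (hy : y ∈ ξ.orthogonal H) (h0 : y ≠ 0) :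
    IsTR ξ (m + 1) (H ⊔ span F {y}) :=
  hH.succ_of_le halt hnd hm le_sup_left
    (by rw [finrank_sup_span_singleton ((hH.2.1 hm).notMem hy h0), hH.1])

/-- The tangential spaces over a regular `H` correspond to the points of `Hᗮ`, and two of them have
a regular join exactly when their points span a hyperbolic line. -/
theorem adj_iff_of_span (halt : ξ.IsAlt) (hm : Even m)
    {H : Submodule F V} (hH : IsTR ξ m H) {y z : V} (hy : y ∈ ξ.orthogonal H)
    (hz : z ∈ ξ.orthogonal H) {Y Z : TR ξ (m + 1)} (hY : Y.1 = H ⊔ span F {y})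
    (hZ : Z.1 = H ⊔ span F {z}) : Adj ξ (m + 1) Y Z ↔ ξ y z ≠ 0 := by
  have hHr := hH.2.1 hm
  have e : Y.1 ⊔ Z.1 = H ⊔ span F {y} ⊔ span F {z} := by
    rw [hY, hZ, sup_sup_sup_comm, sup_idem, sup_assoc]
  constructor
  · intro h h0
    rw [adj_iff, e] at h
    have hreg := isRegular_iff.1 (h.2.2.2.1 (by simpa [parity_simps] using hm))
    have hy0 : y = 0 := by
      refine hreg y (mem_sup_left (mem_sup_right (mem_span_singleton_self y))) fun u hu => ?_
      obtain ⟨w, hw, c, rfl⟩ := mem_sup_span_singleton.1 hu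
      obtain ⟨w', hw', b, rfl⟩ := mem_sup_span_singleton.1 hw
      have h1 : ξ z y = 0 := halt.isRefl _ _ h0
      simp [hy w' hw', halt y, h1]
    have := Y.finrank_eq
    rw [hY, hy0, span_zero_singleton, sup_bot_eq, hH.1] at this
    omega
  · intro h0
    have hd := hHr.finrank_sup_sup halt hy hz h0
    have hne : Y ≠ Z := by
      rintro rfl
      rw [← e, sup_idem, Y.finrank_eq, hH.1] at hd
      omega
    refine adj_iff.2 ⟨hne, ?_, ?_⟩
    · rw [TR.inf_eq hne hH.1 (hY ▸ le_sup_left) (hZ ▸ le_sup_left)]; exact hH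
    · rw [e]
      exact ⟨by rw [hd, hH.1], fun _ => hHr.sup_sup halt hy hz h0,
        fun h => absurd (hm.add even_two) h⟩

end TR

/-! ### Nearness is definable from adjacency -/

section Near

/-- Two distinct elements span a member of `(T-R)` or intersect in one, with dimension differing by
one. -/
def Near (ξ : LinearMap.BilinForm F V) (m : ℕ) (X Y : TR ξ (m + 1)) : Prop :=
  X ≠ Y ∧ (IsTR ξ m (X.1 ⊓ Y.1) ∨ IsTR ξ (m + 2) (X.1 ⊔ Y.1))

/-- The common neighbourhood contains two adjacent elements and two distinct nonadjacent common
neighbours of these. -/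
def HasDiamond (ξ : LinearMap.BilinForm F V) (k : ℕ) (X Y : TR ξ k) : Prop :=
  ∃ A B P Q : TR ξ k, (∀ Z, Z = A ∨ Z = B ∨ Z = P ∨ Z = Q → Adj ξ k Z X ∧ Adj ξ k Z Y) ∧
    Adj ξ k A B ∧ Adj ξ k P A ∧ Adj ξ k P B ∧ Adj ξ k Q A ∧ Adj ξ k Q B ∧ P ≠ Q ∧ ¬ Adj ξ k P Q

theorem Near.finrank_inf {X Y : TR ξ (m + 1)} (h : Near ξ m X Y) :
    finrank F ↥(X.1 ⊓ Y.1) = m := by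
  have := X.finrank_sup_add Y
  rcases h.2 with h | h
  · exact h.1
  · have := h.1
    omega

theorem Adj.near {X Y : TR ξ (m + 1)} (h : Adj ξ (m + 1) X Y) : Near ξ m X Y :=
  ⟨h.1, Or.inl (adj_iff.1 h).2.1⟩

/-- The hyperplanes `P ⊓ X` and `P ⊓ Y` of `P` either coincide, and then equal `X ⊓ Y`, or span `P`,
and then `X ⊔ Y = P ⊔ X`. Adjacency of `P` and `X` puts either one in (T-R). -/
theorem near_of_common {X Y P : TR ξ (m + 1)} (hne : X ≠ Y) (h : finrank F ↥(X.1 ⊓ Y.1) = m)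
    (hX : Adj ξ (m + 1) P X) (hY : Adj ξ (m + 1) P Y) : Near ξ m X Y := by
  rw [adj_iff] at hX hY
  refine ⟨hne, ?_⟩
  by_cases e : P.1 ⊓ X.1 = P.1 ⊓ Y.1
  · left
    rw [TR.inf_eq hne hX.2.1.1 inf_le_right (e ▸ inf_le_right)]
    exact hX.2.1
  · right
    have h1 : P.1 ⊓ X.1 ⊔ P.1 ⊓ Y.1 = P.1 := sup_eq_of_finrank inf_le_left inf_le_left
      (by rw [hX.2.1.1, P.finrank_eq]) (by rw [hX.2.1.1, hY.2.1.1]) e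
    have h2 : P.1 ≤ X.1 ⊔ Y.1 := by
      rw [← h1]; exact sup_le_sup inf_le_right inf_le_right
    have h3 := X.finrank_sup_add Y
    rw [← TR.sup_eq hX.1 (by omega) h2 le_sup_left]
    exact hX.2.2

section Distant

variable {X Y : TR ξ (m + 1)} (hne : X ≠ Y) (hd : finrank F ↥(X.1 ⊓ Y.1) ≠ m)
include hne hd

/-- Coinciding traces of `P` would give `X ⊓ Y` dimension `m`. Distinct traces span `P` and meet in
dimension `m - 1`, which fixes the dimensions of `X ⊓ Y` and `X ⊔ Y`. -/
theorem sup_eq_of_common {P : TR ξ (m + 1)}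
    (hX : Adj ξ (m + 1) P X) (hY : Adj ξ (m + 1) P Y) :
    P.1 ⊓ X.1 ⊔ P.1 ⊓ Y.1 = P.1 ∧ finrank F ↥(X.1 ⊔ Y.1) = m + 3 := by
  rw [adj_iff] at hX hY
  have hle := TR.finrank_inf_le hne
  have h1 : P.1 ⊓ X.1 ⊔ P.1 ⊓ Y.1 = P.1 := by
    refine sup_eq_of_finrank inf_le_left inf_le_left
      (by rw [hX.2.1.1, P.finrank_eq]) (by rw [hX.2.1.1, hY.2.1.1]) fun e => hd ?_
    have := finrank_mono (le_inf inf_le_right (e ▸ inf_le_right) : P.1 ⊓ X.1 ≤ X.1 ⊓ Y.1)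
    rw [hX.2.1.1] at this
    omega
  refine ⟨h1, ?_⟩
  have h2 := finrank_sup_add_finrank_inf_eq (P.1 ⊓ X.1) (P.1 ⊓ Y.1)
  rw [h1, hX.2.1.1, hY.2.1.1, P.finrank_eq] at h2
  have h3 := finrank_mono (inf_le_inf inf_le_right inf_le_right :
    (P.1 ⊓ X.1) ⊓ (P.1 ⊓ Y.1) ≤ X.1 ⊓ Y.1)
  have := X.finrank_sup_add Y
  omega

/-- If `A` and `B` had different traces on both `X` and `Y`, these would span `X` and `Y`, placing
the `(m + 3)`-dimensional `X ⊔ Y` inside the `(m + 2)`-dimensional `A ⊔ B`. -/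
theorem inf_eq_or_inf_eq_of_common {A B : TR ξ (m + 1)}
    (hAX : Adj ξ (m + 1) A X) (hAY : Adj ξ (m + 1) A Y) (hBX : Adj ξ (m + 1) B X)
    (hBY : Adj ξ (m + 1) B Y) (hAB : Adj ξ (m + 1) A B) :
    A.1 ⊓ X.1 = B.1 ⊓ X.1 ∨ A.1 ⊓ Y.1 = B.1 ⊓ Y.1 := by
  have h1 := (sup_eq_of_common hne hd hAX hAY).2
  rw [adj_iff] at hAX hAY hBX hBY hAB
  by_contra! hc
  have e1 : A.1 ⊓ X.1 ⊔ B.1 ⊓ X.1 = X.1 := sup_eq_of_finrank inf_le_right inf_le_right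
    (by rw [hAX.2.1.1, X.finrank_eq]) (by rw [hAX.2.1.1, hBX.2.1.1]) hc.1
  have e2 : A.1 ⊓ Y.1 ⊔ B.1 ⊓ Y.1 = Y.1 := sup_eq_of_finrank inf_le_right inf_le_right
    (by rw [hAY.2.1.1, Y.finrank_eq]) (by rw [hAY.2.1.1, hBY.2.1.1]) hc.2
  have h2 : X.1 ⊔ Y.1 ≤ A.1 ⊔ B.1 := by
    rw [← e1, ← e2]
    exact sup_le (sup_le_sup inf_le_left inf_le_left) (sup_le_sup inf_le_left inf_le_left)
  have := finrank_mono h2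
  rw [h1, hAB.2.2.1] at this
  omega

/-- As `A` and `B` share their trace on `X`, their traces on `Y` differ. A common neighbour of `X`,
`Y`, `A`, `B` cannot share a trace on `Y` with both, so it has the same trace on `X` as `A`. Hence
`P` and `Q` lie in the pencil between `A ⊓ X` and `A ⊔ Y`. -/
theorem adj_of_diamond {A B P Q : TR ξ (m + 1)}
    (hZ : ∀ Z, Z = A ∨ Z = B ∨ Z = P ∨ Z = Q → Adj ξ (m + 1) Z X ∧ Adj ξ (m + 1) Z Y)
    (hAB : Adj ξ (m + 1) A B) (hPA : Adj ξ (m + 1) P A) (hPB : Adj ξ (m + 1) P B)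
    (hQA : Adj ξ (m + 1) Q A) (hQB : Adj ξ (m + 1) Q B) (hPQ : P ≠ Q)
    (hx : A.1 ⊓ X.1 = B.1 ⊓ X.1) : Adj ξ (m + 1) P Q := by
  have hA := hZ A (by simp)
  have hB := hZ B (by simp)
  have hy : A.1 ⊓ Y.1 ≠ B.1 ⊓ Y.1 := fun hy => hAB.1 <| Subtype.ext <| by
    rw [← (sup_eq_of_common hne hd hA.1 hA.2).1, hx, hy, (sup_eq_of_common hne hd hB.1 hB.2).1]
  have key : ∀ Z : TR ξ (m + 1), Adj ξ (m + 1) Z X → Adj ξ (m + 1) Z Y → Adj ξ (m + 1) Z A →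
      Adj ξ (m + 1) Z B → Z.1 ⊓ X.1 = A.1 ⊓ X.1 ∧ Z.1 ≤ A.1 ⊔ Y.1 := by
    intro Z h1 h2 h3 h4
    have e : Z.1 ⊓ X.1 = A.1 ⊓ X.1 := by
      rcases inf_eq_or_inf_eq_of_common hne hd h1 h2 hA.1 hA.2 h3 with h | h
      · exact h
      rcases inf_eq_or_inf_eq_of_common hne hd h1 h2 hB.1 hB.2 h4 with h' | h'
      · exact h'.trans hx.symm
      exact absurd (h.symm.trans h') hy
    refine ⟨e, ?_⟩
    rw [← (sup_eq_of_common hne hd h1 h2).1, e]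
    exact sup_le_sup inf_le_left inf_le_right
  obtain ⟨p1, p2⟩ := key P (hZ P (by simp)).1 (hZ P (by simp)).2 hPA hPB
  obtain ⟨q1, q2⟩ := key Q (hZ Q (by simp)).1 (hZ Q (by simp)).2 hQA hQB
  have hAX := adj_iff.1 hA.1
  have hAY := adj_iff.1 hA.2
  refine adj_iff.2 ⟨hPQ, ?_, ?_⟩
  · rw [TR.inf_eq hPQ hAX.2.1.1 (p1 ▸ inf_le_left) (q1 ▸ inf_le_left)]
    exact hAX.2.1
  · rw [TR.sup_eq hPQ hAY.2.2.1 p2 q2]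
    exact hAY.2.2

end Distant

theorem HasDiamond.near {X Y : TR ξ (m + 1)} (hne : X ≠ Y) (h : HasDiamond ξ (m + 1) X Y) :
    Near ξ m X Y := by
  obtain ⟨A, B, P, Q, hZ, hAB, hPA, hPB, hQA, hQB, hPQ, hn⟩ := h
  have hA := hZ A (by simp)
  have hB := hZ B (by simp)
  by_cases hd : finrank F ↥(X.1 ⊓ Y.1) = m
  · exact near_of_common hne hd hA.1 hA.2
  · refine absurd ?_ hn
    rcases inf_eq_or_inf_eq_of_common hne hd hA.1 hA.2 hB.1 hB.2 hAB with h | h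
    · exact adj_of_diamond hne hd hZ hAB hPA hPB hQA hQB hPQ h
    · exact adj_of_diamond hne.symm (inf_comm X.1 Y.1 ▸ hd) (fun Z hz => (hZ Z hz).symm)
        hAB hPA hPB hQA hQB hPQ h

theorem HasDiamond.map {k k' : ℕ} (f : TR ξ k ≃ TR ξ k')
    (hf : ∀ X Y, Adj ξ k' (f X) (f Y) ↔ Adj ξ k X Y) {X Y : TR ξ k} (h : HasDiamond ξ k X Y) :
    HasDiamond ξ k' (f X) (f Y) := by
  obtain ⟨A, B, P, Q, hZ, h⟩ := h
  refine ⟨f A, f B, f P, f Q, ?_, ?_⟩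
  · rintro Z (rfl | rfl | rfl | rfl) <;> rw [hf, hf] <;> exact hZ _ (by simp)
  · simpa [hf] using h

theorem adj_symm_iff {k k' : ℕ} {f : TR ξ k ≃ TR ξ k'}
    (hf : ∀ X Y, Adj ξ k' (f X) (f Y) ↔ Adj ξ k X Y) (X Y : TR ξ k') :
    Adj ξ k (f.symm X) (f.symm Y) ↔ Adj ξ k' X Y := by
  rw [← hf, f.apply_symm_apply, f.apply_symm_apply]

theorem hasDiamond_map_iff {k k' : ℕ} (f : TR ξ k ≃ TR ξ k')
    (hf : ∀ X Y, Adj ξ k' (f X) (f Y) ↔ Adj ξ k X Y) {X Y : TR ξ k} :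
    HasDiamond ξ k' (f X) (f Y) ↔ HasDiamond ξ k X Y := by
  refine ⟨fun h => ?_, HasDiamond.map f hf⟩
  simpa using h.map f.symm (adj_symm_iff hf)

/-- Nonadjacency forces the tangential level, where `X` and `Y` are orthogonal points `y`, `z` of
`Hᗮ`. The diamond is built there from a vector `d` pairing to `1` with both. -/
theorem hasDiamond_of_isTR_inf (h2 : (2 : F) ≠ 0) (halt : ξ.IsAlt) (hnd : ξ.Nondegenerate)
    {X Y : TR ξ (m + 1)} (hne : X ≠ Y) (hH : IsTR ξ m (X.1 ⊓ Y.1)) (hn : ¬ Adj ξ (m + 1) X Y) :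
    HasDiamond ξ (m + 1) X Y := by
  have hm : Even m := by
    by_contra hm
    exact hn (adj_of_even halt hnd (by simpa [parity_simps] using hm) hne hH.1)
  set H := X.1 ⊓ Y.1 with hHdef
  obtain ⟨y, hy, hy0, hX⟩ := hH.exists_span hnd hm X.finrank_eq inf_le_left
  obtain ⟨z, hz, hz0, hY⟩ := hH.exists_span hnd hm Y.finrank_eq inf_le_right
  have hyz : ξ y z = 0 := by
    by_contra h
    exact hn ((adj_iff_of_span halt hm hH hy hz hX hY).2 h)
  have hzy : ξ z y = 0 := halt.isRefl _ _ hyz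
  have hyZ : y ∉ span F {z} := by
    intro h
    apply hne
    apply TR.eq_of_le
    rw [hX, hY]
    exact sup_le_sup_left ((span_singleton_le_iff_mem _ _).2 h) _
  -- A vector orthogonal to `y - z` but not to `z` pairs equally and nontrivially with `y` and `z`;
  -- its component in `Hᗮ`, rescaled, is the desired `d`.
  have hspan : ¬ ξ.orthogonal (span F {y - z}) ≤ ξ.orthogonal (span F {z}) := by
    rw [orthogonal_le_orthogonal_iff halt hnd, span_singleton_le_iff_mem, mem_span_singleton]
    rintro ⟨c, hc⟩
    have hc0 : c ≠ 0 := by rintro rfl; exact hz0 (by simpa using hc.symm)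
    apply hyZ
    have : y = (y - z) + z := by abel
    have h4 : y - z = c⁻¹ • z := by
      rw [← inv_smul_smul₀ hc0 (y - z), hc]
    rw [this, h4]
    exact add_mem (smul_mem _ _ (mem_span_singleton_self z)) (mem_span_singleton_self z)
  obtain ⟨v, hv, hv'⟩ := SetLike.not_le_iff_exists.1 hspan
  rw [mem_orthogonal_span_singleton] at hv hv'
  obtain ⟨h, hh, d, hd, rfl⟩ := (hH.2.1 hm).exists_add hnd v
  have hyh : ξ y h = 0 := halt.isRefl _ _ (hy h hh)
  have hzh : ξ z h = 0 := halt.isRefl _ _ (hz h hh)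
  simp only [map_add, hzh, zero_add, map_sub, LinearMap.sub_apply, hyh, sub_zero] at hv hv'
  obtain ⟨d, hd, hyd, hzd⟩ : ∃ d ∈ ξ.orthogonal H, ξ y d = 1 ∧ ξ z d = 1 := by
    refine ⟨(ξ z d)⁻¹ • d, smul_mem _ _ hd, ?_, ?_⟩
    · simp [sub_eq_zero.1 hv, hv']
    · simp [hv']
  have hdy : ξ d y = -1 := by rw [← halt.neg_eq, hyd]
  have hdz : ξ d z = -1 := by rw [← halt.neg_eq, hzd]
  have hdd := halt d
  have hyy := halt y
  have hzz := halt z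
  have hp : d ∈ ξ.orthogonal H := hd
  have hq : d + y - z ∈ ξ.orthogonal H := sub_mem (add_mem hd hy) hz
  have ha : d + y ∈ ξ.orthogonal H := add_mem hd hy
  have hb : d - y ∈ ξ.orthogonal H := sub_mem hd hy
  have ne0 : ∀ w, ξ y w = 1 → w ≠ 0 := by rintro w hw rfl; simp at hw
  have hp1 : d ≠ 0 := ne0 _ hyd
  have hq1 : d + y - z ≠ 0 := ne0 _ (by simp [hyd, hyy, hyz])
  have ha1 : d + y ≠ 0 := ne0 _ (by simp [hyd, hyy])
  have hb1 : d - y ≠ 0 := ne0 _ (by simp [hyd, hyy])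
  let pt : {w // w ∈ ξ.orthogonal H ∧ w ≠ 0} → TR ξ (m + 1) :=
    fun w => ⟨_, hH.sup_span halt hnd hm w.2.1 w.2.2⟩
  have hadj : ∀ w w', ξ w.1 w'.1 ≠ 0 ↔ Adj ξ (m + 1) (pt w) (pt w') :=
    fun w w' => (adj_iff_of_span halt hm hH w.2.1 w'.2.1 rfl rfl).symm
  have hX' : X = pt ⟨y, hy, hy0⟩ := Subtype.ext hX
  have hY' : Y = pt ⟨z, hz, hz0⟩ := Subtype.ext hY
  -- The four points are `d + y`, `d - y`, `d`, `d + y - z`. The first two pair to `2`, which is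
  -- where characteristic `≠ 2` is needed; the last two pair to `0`.
  refine ⟨pt ⟨_, ha, ha1⟩, pt ⟨_, hb, hb1⟩, pt ⟨_, hp, hp1⟩, pt ⟨_, hq, hq1⟩, ?_, ?_, ?_, ?_, ?_,
    ?_, ?_, ?_⟩
  · rw [hX', hY']
    rintro Z (rfl | rfl | rfl | rfl) <;> rw [← hadj, ← hadj] <;>
      simp [hdy, hdz, hyy, hzz, hyz, hzy]
  · rw [← hadj]
    simp only [map_add, map_sub, LinearMap.add_apply, hdd, hdy, hyd, hyy]
    intro h0
    apply h2
    linear_combination h0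
  · rw [← hadj]; simp [hdd, hdy]
  · rw [← hadj]; simp [hdd, hdy]
  · rw [← hadj]; simp [hdd, hdy, hyd, hyy, hzd, hzy]
  · rw [← hadj]; simp [hdd, hdy, hyd, hyy, hzd, hzy]
  · intro e
    have hmem : d + y - z ∈ H ⊔ span F {d} := by
      have : d + y - z ∈ (pt ⟨_, hq, hq1⟩).1 := mem_sup_right (mem_span_singleton_self _)
      rw [← e] at this
      exact this
    obtain ⟨h, hh, c, hc⟩ := mem_sup_span_singleton.1 hmem
    have h1 : ξ y h = 0 := halt.isRefl _ _ (hy h hh)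
    have h3 := congrArg (ξ y) hc
    simp only [map_add, map_sub, map_smul, hyd, hyy, hyz, h1, smul_eq_mul] at h3
    have hc1 : c = 1 := by linear_combination -h3
    subst hc1
    have h4 : y - z = h := by
      have : y - z = (d + y - z) - d := by abel
      rw [this, hc]; simp
    have h5 : y - z = 0 := by
      by_contra h5
      exact (hH.2.1 hm).notMem (sub_mem hy hz) h5 (h4 ▸ hh)
    exact hyZ (sub_eq_zero.1 h5 ▸ mem_span_singleton_self y)
  · rw [← hadj]; simp [hdd, hdy, hdz]

/-- Makes `Near` an invariant of the adjacency graph. A pair whose join is in (T-R) is carried by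
duality to a pair whose meet is. -/
theorem near_iff (h2 : (2 : F) ≠ 0) (halt : ξ.IsAlt) (hnd : ξ.Nondegenerate)
    {X Y : TR ξ (m + 1)} :
    Near ξ m X Y ↔ X ≠ Y ∧ (Adj ξ (m + 1) X Y ∨ HasDiamond ξ (m + 1) X Y) := by
  constructor
  · rintro ⟨hne, h⟩
    refine ⟨hne, or_iff_not_imp_left.2 fun hn => ?_⟩
    rcases h with h | h
    · exact hasDiamond_of_isTR_inf h2 halt hnd hne h hn
    · have h3 := h.1
      have h4 := (X.1 ⊔ Y.1).finrank_le
      obtain ⟨m', hm'⟩ : ∃ m', m + 1 + (m' + 1) = finrank F V :=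
        ⟨finrank F V - (m + 2), by omega⟩
      rw [← hasDiamond_map_iff (orthogonalEquiv halt hnd hm')
        (fun X Y => adj_orthogonalEquiv halt hnd hm')]
      refine hasDiamond_of_isTR_inf h2 halt hnd (fun e => hne (Equiv.injective _ e)) ?_
        (by rwa [adj_orthogonalEquiv])
      have e1 : (orthogonalEquiv halt hnd hm' X).1 ⊓ (orthogonalEquiv halt hnd hm' Y).1 =
        ξ.orthogonal (X.1 ⊔ Y.1) := (orthogonal_sup _ _).symm
      rw [e1]
      exact (isTR_orthogonal (m := m + 2) halt hnd (by omega)).2 h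
  · rintro ⟨hne, h | h⟩
    · exact h.near
    · exact h.near hne

theorem near_map_iff (h2 : (2 : F) ≠ 0) (halt : ξ.IsAlt) (hnd : ξ.Nondegenerate)
    (f : TR ξ (m + 1) ≃ TR ξ (m' + 1))
    (hf : ∀ X Y, Adj ξ (m' + 1) (f X) (f Y) ↔ Adj ξ (m + 1) X Y) {X Y : TR ξ (m + 1)} :
    Near ξ m' (f X) (f Y) ↔ Near ξ m X Y := by
  rw [near_iff h2 halt hnd, near_iff h2 halt hnd, hf, hasDiamond_map_iff f hf, f.injective.ne_iff]

end Near

end SymplecticGrassmann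

namespace SymplecticGrassmann

open Module Submodule

set_option linter.unusedSectionVars false

variable {F V : Type*} [Field F] [AddCommGroup V] [Module F V] {ξ : LinearMap.BilinForm F V}
  [FiniteDimensional F V] {m m' : ℕ}

/-! ### Existence of members above, below and inside pencils -/

section Pencils

theorem IsTangential.exists_mem_rad {U : Submodule F V} (h : IsTangential ξ U) :
    ∃ r ≠ 0, r ∈ rad ξ U ∧ ∀ x ∈ rad ξ U, ∃ c : F, x = c • r := by
  obtain ⟨r, hr, hc⟩ := finrank_eq_one_iff'.1 h
  refine ⟨r.1, by simpa using hr, r.2, fun x hx => ?_⟩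
  obtain ⟨c, hc⟩ := hc ⟨x, hx⟩
  exact ⟨c, (congrArg Subtype.val hc).symm⟩

/-- For a radical vector of the sum, pairing with `r` kills the coefficient of `w`; what remains is
in the radical line of `H`, and pairing with `w` kills it too. -/
theorem IsTR.sup_span_of_odd (halt : ξ.IsAlt) (hm : ¬ Even m) {H : Submodule F V}
    (hH : IsTR ξ m H) {r w : V} (hr : r ∈ rad ξ H) (hw : ξ r w ≠ 0) :
    w ∉ H ∧ IsTR ξ (m + 1) (H ⊔ span F {w}) := by
  have hwH : w ∉ H := fun h => hw (halt.isRefl _ _ (hr.2 w h))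
  refine ⟨hwH, by rw [finrank_sup_span_singleton hwH, hH.1], fun _ => ?_,
    fun h => absurd (by simpa [parity_simps] using hm) h⟩
  rw [isRegular_iff]
  intro x hx hu
  obtain ⟨h, hh, c, rfl⟩ := mem_sup_span_singleton.1 hx
  have e1 := hu r (mem_sup_left hr.1)
  have hrh : ξ r h = 0 := halt.isRefl _ _ (hr.2 h hh)
  simp only [map_add, map_smul, hrh, smul_eq_mul, zero_add, mul_eq_zero, hw, or_false] at e1
  subst e1
  simp only [zero_smul, add_zero] at hu ⊢
  obtain ⟨r', hr'0, hr', hspan⟩ := (hH.2.2 hm).exists_mem_rad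
  obtain ⟨c, rfl⟩ := hspan r hr
  obtain ⟨d, rfl⟩ := hspan h ⟨hh, fun u hu' => hu u (mem_sup_left hu')⟩
  have e2 := hu w (mem_sup_right (mem_span_singleton_self w))
  have e3 : ξ w r' ≠ 0 := fun h => hw (by simp [halt.isRefl _ _ h])
  simp only [map_smul, smul_eq_mul, mul_eq_zero, e3, or_false] at e2
  simp [e2]

/-- In a star (or a pencil), every element has a neighbour outside a given proper subspace. -/
theorem exists_adj_in_pencil (halt : ξ.IsAlt) (hnd : ξ.Nondegenerate) {H : Submodule F V}
    (hH : IsTR ξ m H) {X : TR ξ (m + 1)} (hHX : H ≤ X.1) {B Z : Submodule F V} (hXB : X.1 ≤ B)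
    (hB : Even m → IsRegular ξ B) (hXZ : X.1 ≤ Z) (hBZ : ¬ B ≤ Z) :
    ∃ W : TR ξ (m + 1), H ≤ W.1 ∧ W.1 ≤ B ∧ Adj ξ (m + 1) X W ∧ ¬ W.1 ≤ Z := by
  by_cases hm : Even m
  · obtain ⟨y, hy, hy0, hX⟩ := hH.exists_span hnd hm X.finrank_eq hHX
    have hyX : y ∈ X.1 := by rw [hX]; exact mem_sup_right (mem_span_singleton_self y)
    have hBy : ¬ B ≤ ξ.orthogonal (span F {y}) := fun h => hy0 <|
      isRegular_iff.1 (hB hm) y (hXB hyX) fun u hu =>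
        halt.isRefl _ _ (mem_orthogonal_span_singleton.1 (h hu))
    -- Avoiding `Z` makes the new member escape `Z`; avoiding the orthogonal of `y` makes it
    -- adjacent to `X`.
    obtain ⟨w, hwB, hwZ, hyw⟩ := exists_mem_notMem_notMem hBZ hBy
    rw [mem_orthogonal_span_singleton] at hyw
    obtain ⟨h, hh, d, hd, rfl⟩ := (hH.2.1 hm).exists_add hnd w
    have hyh : ξ y h = 0 := halt.isRefl _ _ (hy h hh)
    rw [map_add, hyh, zero_add] at hyw
    have hd0 : d ≠ 0 := by rintro rfl; simp at hyw
    have hdB : d ∈ B := (B.add_mem_iff_right (hXB (hHX hh))).1 hwB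
    refine ⟨⟨_, hH.sup_span halt hnd hm hd hd0⟩, le_sup_left,
      sup_le (hHX.trans hXB) ((span_singleton_le_iff_mem _ _).2 hdB),
      (adj_iff_of_span halt hm hH hy hd hX rfl).2 hyw, fun hle => hwZ ?_⟩
    exact add_mem (hXZ (hHX hh)) (hle (mem_sup_right (mem_span_singleton_self d)))
  · have hm' : Even (m + 1) := by simpa [parity_simps] using hm
    obtain ⟨r, hr0, hr, -⟩ := (hH.2.2 hm).exists_mem_rad
    have hBr : ¬ B ≤ ξ.orthogonal (span F {r}) := fun h => hr0 <|
      isRegular_iff.1 (X.2.2.1 hm') r (hHX hr.1) fun u hu =>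
        halt.isRefl _ _ (mem_orthogonal_span_singleton.1 (h (hXB hu)))
    obtain ⟨w, hwB, hwZ, hrw⟩ := exists_mem_notMem_notMem hBZ hBr
    rw [mem_orthogonal_span_singleton] at hrw
    have hW := hH.sup_span_of_odd halt hm hr hrw
    have hwW : ¬ (H ⊔ span F {w}) ≤ Z := fun hle =>
      hwZ (hle (mem_sup_right (mem_span_singleton_self w)))
    have hne : X ≠ ⟨_, hW.2⟩ := by
      intro e
      apply hwW
      have := congrArg Subtype.val e
      simp only at this
      rw [← this]
      exact hXZ
    refine ⟨⟨_, hW.2⟩, le_sup_left,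
      sup_le (hHX.trans hXB) ((span_singleton_le_iff_mem _ _).2 hwB),
      adj_of_even halt hnd hm' hne ?_, hwW⟩
    rw [TR.inf_eq hne hH.1 hHX le_sup_left, hH.1]

theorem isRegular_top (hnd : ξ.Nondegenerate) : IsRegular ξ (⊤ : Submodule F V) := by
  rw [IsRegular, rad, LinearMap.BilinForm.orthogonal_top_eq_bot hnd, inf_bot_eq]

theorem IsTR.exists_ge (halt : ξ.IsAlt) (hnd : ξ.Nondegenerate) (hm : m < finrank F V)
    {H : Submodule F V} (hH : IsTR ξ m H) : ∃ X : TR ξ (m + 1), H ≤ X.1 := by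
  by_cases he : Even m
  · have h1 := finrank_add_finrank_orthogonal_eq hnd H
    obtain ⟨y, hy, h0⟩ := exists_mem_ne_zero_of_ne_bot
      (fun h : ξ.orthogonal H = ⊥ => by rw [h, finrank_bot, hH.1] at h1; omega)
    exact ⟨⟨_, hH.sup_span halt hnd he hy h0⟩, le_sup_left⟩
  · obtain ⟨r, hr0, hr, -⟩ := (hH.2.2 he).exists_mem_rad
    obtain ⟨w, hw⟩ : ∃ w, ξ r w ≠ 0 := by
      by_contra! hc
      exact hr0 (hnd.1 r hc)
    exact ⟨⟨_, (hH.sup_span_of_odd halt he hr hw).2⟩, le_sup_left⟩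

theorem IsTR.exists_le (halt : ξ.IsAlt) (hnd : ξ.Nondegenerate)
    {B : Submodule F V} (hB : IsTR ξ (m + 1) B) : ∃ H : TR ξ m, H.1 ≤ B := by
  have h1 := finrank_add_finrank_orthogonal_eq hnd B
  rw [hB.1] at h1
  obtain ⟨X, hX⟩ := ((isTR_orthogonal halt hnd h1).2 hB).exists_ge halt hnd (by omega)
  refine ⟨⟨ξ.orthogonal X.1, (isTR_orthogonal halt hnd (by omega)).2 X.2⟩, ?_⟩
  exact (LinearMap.BilinForm.orthogonal_le hX).trans (orthogonal_orthogonal_eq halt hnd B).le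

end Pencils

/-! ### Stars and tops as maximal cliques -/

section Blocks

/-- The star of all `U` in `(T-R)_{m+1}` containing `H`. -/
def star (ξ : LinearMap.BilinForm F V) (m : ℕ) (H : Submodule F V) : Set (TR ξ (m + 1)) :=
  {U | H ≤ U.1}

/-- The top of all `U` in `(T-R)_{m+1}` contained in `B`. -/
def top (ξ : LinearMap.BilinForm F V) (m : ℕ) (B : Submodule F V) : Set (TR ξ (m + 1)) :=
  {U | U.1 ≤ B}

/-- Maximal cliques of `Near` containing an adjacent pair. -/
def IsBlock (ξ : LinearMap.BilinForm F V) (m : ℕ) (C : Set (TR ξ (m + 1))) : Prop :=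
  (∀ X ∈ C, ∀ Y ∈ C, X ≠ Y → Near ξ m X Y) ∧ (∃ X ∈ C, ∃ Y ∈ C, Adj ξ (m + 1) X Y) ∧
    ∀ Z, (∀ X ∈ C, Z ≠ X → Near ξ m Z X) → Z ∈ C

theorem IsBlock.preimage (h2 : (2 : F) ≠ 0) (halt : ξ.IsAlt) (hnd : ξ.Nondegenerate)
    {f : TR ξ (m + 1) ≃ TR ξ (m' + 1)}
    (hf : ∀ X Y, Adj ξ (m' + 1) (f X) (f Y) ↔ Adj ξ (m + 1) X Y) {C : Set (TR ξ (m' + 1))}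
    (hC : IsBlock ξ m' C) : IsBlock ξ m (f ⁻¹' C) := by
  obtain ⟨h1, ⟨X, hX, Y, hY, hXY⟩, h3⟩ := hC
  refine ⟨fun X hX Y hY hne => ?_, ⟨f.symm X, by simpa, f.symm Y, by simpa, ?_⟩, fun Z hZ => ?_⟩
  · rw [← near_map_iff h2 halt hnd f hf]
    exact h1 _ hX _ hY (f.injective.ne hne)
  · rwa [adj_symm_iff hf]
  · refine h3 _ fun X hX hne => ?_
    have := hZ (f.symm X) (by simpa) (fun e => hne (by simp [e]))
    rwa [← near_map_iff h2 halt hnd f hf, f.apply_symm_apply] at this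

theorem near_of_mem_star {H : Submodule F V} (hH : IsTR ξ m H) {X Y : TR ξ (m + 1)}
    (hX : X ∈ star ξ m H) (hY : Y ∈ star ξ m H) (hne : X ≠ Y) : Near ξ m X Y :=
  ⟨hne, Or.inl (by rw [TR.inf_eq hne hH.1 hX hY]; exact hH)⟩

theorem near_of_mem_top {B : Submodule F V} (hB : IsTR ξ (m + 2) B) {X Y : TR ξ (m + 1)}
    (hX : X ∈ top ξ m B) (hY : Y ∈ top ξ m B) (hne : X ≠ Y) : Near ξ m X Y :=
  ⟨hne, Or.inr (by rw [TR.sup_eq hne hB.1 hX hY]; exact hB)⟩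

/-- The hyperplanes `Z ⊓ X` and `Z ⊓ Y` of `Z` either coincide with `X ⊓ Y` or span `Z`. -/
theorem inf_le_or_le_sup_of_near {X Y Z : TR ξ (m + 1)} (h : Near ξ m X Y) (hX : Near ξ m Z X)
    (hY : Near ξ m Z Y) : X.1 ⊓ Y.1 ≤ Z.1 ∨ Z.1 ≤ X.1 ⊔ Y.1 := by
  by_cases e : Z.1 ⊓ X.1 = Z.1 ⊓ Y.1
  · left
    rw [TR.inf_eq h.1 hX.finrank_inf inf_le_right (e ▸ inf_le_right)]
    exact inf_le_left
  · right
    have h1 : Z.1 ⊓ X.1 ⊔ Z.1 ⊓ Y.1 = Z.1 := sup_eq_of_finrank inf_le_left inf_le_left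
      (by rw [hX.finrank_inf, Z.finrank_eq]) (by rw [hX.finrank_inf, hY.finrank_inf]) e
    rw [← h1]
    exact sup_le_sup inf_le_right inf_le_right

/-- For maximality, a `Z` near the whole star but not over `H` lies in `X ⊔ Y` for every `Y` of the
star adjacent to `X`. Two such joins with intersection `X` exist because `m + 2 < dim V`, so `Z =
X`, a contradiction. -/
theorem isBlock_star (halt : ξ.IsAlt) (hnd : ξ.Nondegenerate) (hm : m + 2 < finrank F V)
    {H : Submodule F V} (hH : IsTR ξ m H) : IsBlock ξ m (star ξ m H) := by
  obtain ⟨X, hX⟩ := hH.exists_ge halt hnd (by omega)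
  have notTop : ∀ U : Submodule F V, finrank F U < finrank F V → ¬ ⊤ ≤ U := by
    intro U hU h
    rw [top_le_iff.1 h, finrank_top] at hU
    exact lt_irrefl _ hU
  obtain ⟨W, hW, -, hXW, -⟩ := exists_adj_in_pencil halt hnd hH hX le_top
    (fun _ => isRegular_top hnd) le_rfl (notTop _ (by rw [X.finrank_eq]; omega))
  refine ⟨fun X hX Y hY => near_of_mem_star hH hX hY, ⟨X, hX, W, hW, hXW⟩, fun Z hZ => ?_⟩
  have hd := (adj_iff.1 hXW).2.2.1
  obtain ⟨W', hW', -, hXW', hnle⟩ := exists_adj_in_pencil halt hnd hH hX le_top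
    (fun _ => isRegular_top hnd) (le_sup_left : X.1 ≤ X.1 ⊔ W.1) (notTop _ (by rw [hd]; omega))
  by_contra hHZ
  have hne : ∀ Y ∈ star ξ m H, Z ≠ Y := fun Y hY e => hHZ (e ▸ hY)
  have key : ∀ Y ∈ star ξ m H, Adj ξ (m + 1) X Y → Z.1 ≤ X.1 ⊔ Y.1 := by
    intro Y hY hXY
    rcases inf_le_or_le_sup_of_near hXY.near (hZ X hX (hne X hX)) (hZ Y hY (hne Y hY)) with h | h
    · rw [TR.inf_eq hXY.1 hH.1 hX hY] at h
      exact absurd h hHZ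
    · exact h
  have hd' := (adj_iff.1 hXW').2.2.1
  have e : (X.1 ⊔ W.1) ⊓ (X.1 ⊔ W'.1) = X.1 := inf_eq_of_finrank le_sup_left le_sup_left
    (by rw [hd, X.finrank_eq]) (by rw [hd, hd']) (fun e => hnle (e ▸ le_sup_right))
  exact hne X hX (TR.eq_of_le (e ▸ le_inf (key W hW hXW) (key W' hW' hXW')))

theorem preimage_star_orthogonal (halt : ξ.IsAlt) (hnd : ξ.Nondegenerate)
    (h : (m + 1) + (m' + 1) = finrank F V) (B : Submodule F V) :
    orthogonalEquiv halt hnd h ⁻¹' star ξ m' (ξ.orthogonal B) = top ξ m B := by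
  ext U
  exact orthogonal_le_orthogonal_iff halt hnd

theorem preimage_top_orthogonal (halt : ξ.IsAlt) (hnd : ξ.Nondegenerate)
    (h : (m + 1) + (m' + 1) = finrank F V) (H : Submodule F V) :
    orthogonalEquiv halt hnd h ⁻¹' top ξ m' (ξ.orthogonal H) = star ξ m H := by
  ext U
  exact orthogonal_le_orthogonal_iff halt hnd

/-- Dual to stars, with `1 ≤ m` dual to the strict bound used there. For `m = 0` a top is properly
contained in the star of `⊥` unless `dim V = 2`. -/
theorem isBlock_top (h2 : (2 : F) ≠ 0) (halt : ξ.IsAlt) (hnd : ξ.Nondegenerate) (hm : 1 ≤ m)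
    {B : Submodule F V} (hB : IsTR ξ (m + 2) B) : IsBlock ξ m (top ξ m B) := by
  have h := B.finrank_le
  rw [hB.1] at h
  obtain ⟨m', hm'⟩ : ∃ m', m + 1 + (m' + 1) = finrank F V := ⟨finrank F V - (m + 2), by omega⟩
  rw [← preimage_star_orthogonal halt hnd hm']
  exact (isBlock_star halt hnd (by omega) ((isTR_orthogonal halt hnd (by omega)).2 hB)).preimage
    h2 halt hnd fun X Y => adj_orthogonalEquiv halt hnd hm'

theorem IsBlock.eq_star_or_eq_top {C : Set (TR ξ (m + 1))} (hC : IsBlock ξ m C) :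
    (∃ H, IsTR ξ m H ∧ C = star ξ m H) ∨ ∃ B, IsTR ξ (m + 2) B ∧ C = top ξ m B := by
  obtain ⟨h1, ⟨X, hX, Y, hY, hXY⟩, h3⟩ := hC
  have hadj := adj_iff.1 hXY
  by_cases hall : ∀ Z ∈ C, X.1 ⊓ Y.1 ≤ Z.1
  · refine Or.inl ⟨_, hadj.2.1, Set.Subset.antisymm hall fun Z hZ => h3 Z fun W hW hne => ?_⟩
    exact near_of_mem_star hadj.2.1 hZ (hall W hW) hne
  · push Not at hall
    obtain ⟨Z, hZ, hnle⟩ := hall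
    have hZX : Near ξ m Z X := h1 Z hZ X hX fun e => hnle (e ▸ inf_le_left)
    have hZY : Near ξ m Z Y := h1 Z hZ Y hY fun e => hnle (e ▸ inf_le_right)
    have hZB := (inf_le_or_le_sup_of_near hXY.near hZX hZY).resolve_left hnle
    have hall : C ⊆ top ξ m (X.1 ⊔ Y.1) := by
      intro W hW
      by_contra hWB
      have hWX : Near ξ m W X := h1 W hW X hX fun e => hWB (by rw [e]; exact (le_sup_left : X.1 ≤ _))
      have hWY : Near ξ m W Y := h1 W hW Y hY fun e => hWB (by rw [e]; exact (le_sup_right : Y.1 ≤ _))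
      have hHW := (inf_le_or_le_sup_of_near hXY.near hWX hWY).resolve_right hWB
      have hWZ : Near ξ m W Z := h1 W hW Z hZ fun e => hWB (by rw [e]; exact hZB)
      have hlt : W.1 ⊓ (X.1 ⊔ Y.1) < W.1 := lt_of_le_of_ne inf_le_left fun e => hWB (inf_eq_left.1 e)
      have hfr := finrank_lt_finrank_of_lt hlt
      rw [W.finrank_eq] at hfr
      -- A `W` outside the join meets it exactly in `X ⊓ Y`. As `Z` lies in the join and is near
      -- `W`, this forces `W ⊓ Z = X ⊓ Y`, contradicting the choice of `Z`.
      have e1 : X.1 ⊓ Y.1 = W.1 ⊓ (X.1 ⊔ Y.1) :=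
        eq_of_le_of_finrank_le (le_inf hHW (inf_le_left.trans le_sup_left))
          (by rw [hadj.2.1.1]; omega)
      have e2 : W.1 ⊓ Z.1 = X.1 ⊓ Y.1 := by
        rw [e1]
        refine eq_of_le_of_finrank_eq (inf_le_inf_left _ hZB) ?_
        rw [← e1, hWZ.finrank_inf, hadj.2.1.1]
      exact hnle (e2 ▸ inf_le_right)
    refine Or.inr ⟨_, hadj.2.2, Set.Subset.antisymm hall fun Z hZ => h3 Z fun W hW hne => ?_⟩
    exact near_of_mem_top hadj.2.2 hZ (hall hW) hne

theorem eq_of_mem_star {H H' : Submodule F V} (hH : IsTR ξ m H) (hH' : IsTR ξ m H')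
    {X Y : TR ξ (m + 1)} (hne : X ≠ Y) (hX : X ∈ star ξ m H) (hY : Y ∈ star ξ m H)
    (hX' : X ∈ star ξ m H') (hY' : Y ∈ star ξ m H') : H = H' := by
  rw [← TR.inf_eq hne hH.1 hX hY, TR.inf_eq hne hH'.1 hX' hY']

theorem eq_of_mem_top {B B' : Submodule F V} (hB : IsTR ξ (m + 2) B) (hB' : IsTR ξ (m + 2) B')
    {X Y : TR ξ (m + 1)} (hne : X ≠ Y) (hX : X ∈ top ξ m B) (hY : Y ∈ top ξ m B)
    (hX' : X ∈ top ξ m B') (hY' : Y ∈ top ξ m B') : B = B' := by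
  rw [← TR.sup_eq hne hB.1 hX hY, TR.sup_eq hne hB'.1 hX' hY']

theorem star_ne_top (halt : ξ.IsAlt) (hnd : ξ.Nondegenerate) (hm : m + 2 < finrank F V)
    {H B : Submodule F V} (hH : IsTR ξ m H) (hB : finrank F B = m + 2) :
    star ξ m H ≠ top ξ m B := by
  intro e
  obtain ⟨X, hX⟩ := hH.exists_ge halt hnd (by omega)
  have hXB : X ∈ top ξ m B := e ▸ hX
  obtain ⟨W, hW, -, -, hnle⟩ := exists_adj_in_pencil halt hnd hH hX le_top
    (fun _ => isRegular_top hnd) hXB fun h => by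
      rw [top_le_iff.1 h, finrank_top] at hB; omega
  exact hnle (e ▸ hW : W ∈ top ξ m B)

theorem exists_ne_mem_star_top (halt : ξ.IsAlt) (hnd : ξ.Nondegenerate) {H B : Submodule F V}
    (hH : IsTR ξ m H) (hB : IsTR ξ (m + 2) B) {X : TR ξ (m + 1)} (hHX : H ≤ X.1) (hXB : X.1 ≤ B) :
    ∃ W ∈ star ξ m H, W ∈ top ξ m B ∧ X ≠ W := by
  obtain ⟨W, hW, hWB, hadj, -⟩ := exists_adj_in_pencil halt hnd hH hHX hXB
    (fun he => hB.2.1 (he.add even_two)) le_rfl fun h => by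
      have := finrank_mono h
      rw [hB.1, X.finrank_eq] at this
      omega
  exact ⟨W, hW, hWB, hadj.1⟩

theorem star_injective (halt : ξ.IsAlt) (hnd : ξ.Nondegenerate) (hm : m + 2 < finrank F V)
    {H H' : Submodule F V} (hH : IsTR ξ m H) (hH' : IsTR ξ m H')
    (e : star ξ m H = star ξ m H') : H = H' := by
  obtain ⟨-, ⟨X, hX, Y, hY, hXY⟩, -⟩ := isBlock_star halt hnd hm hH
  exact eq_of_mem_star hH hH' hXY.1 hX hY (e ▸ hX) (e ▸ hY)

end Blocks

/-! ### Connectivity of the geometry -/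

section Connectivity

/-- An exchange step: the hyperplane `W ⊓ aᗮ` of `W` has `a` in its radical, so adjoining `u` with
`ξ a u ≠ 0` makes it regular again. -/
theorem TR.exists_neighbour (halt : ξ.IsAlt) (hnd : ξ.Nondegenerate) (hm : Even (m + 1))
    (W : TR ξ (m + 1)) {a u : V} (ha : a ∈ W.1) (hau : ξ a u ≠ 0) :
    ∃ W' : TR ξ (m + 1), (W' = W ∨ Adj ξ (m + 1) W' W) ∧
      W.1 ⊓ ξ.orthogonal (span F {a}) ≤ W'.1 ∧ u ∈ W'.1 := by
  have ha0 : a ≠ 0 := by rintro rfl; simp at hau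
  set H := W.1 ⊓ ξ.orthogonal (span F {a}) with hH
  have hnle : ¬ W.1 ≤ ξ.orthogonal (span F {a}) := fun h => ha0 <|
    isRegular_iff.1 (W.2.2.1 hm) a ha fun u hu =>
      halt.isRefl _ _ (mem_orthogonal_span_singleton.1 (h hu))
  have hlt : H < W.1 := lt_of_le_of_ne inf_le_left fun e => hnle (inf_eq_left.1 e)
  have h1 := finrank_lt_finrank_of_lt hlt
  have h2 := finrank_add_finrank_orthogonal_eq hnd (span F {a})
  rw [finrank_span_singleton ha0] at h2
  have h3 := finrank_sup_add_finrank_inf_eq W.1 (ξ.orthogonal (span F {a}))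
  have h4 := (W.1 ⊔ ξ.orthogonal (span F {a})).finrank_le
  rw [← hH] at h3
  rw [W.finrank_eq] at h1 h3
  have hHd : finrank F H = m := by omega
  have hHTR : IsTR ξ m H := W.2.of_succ_of_ge halt hnd hm inf_le_left hHd
  have har : a ∈ rad ξ H := ⟨⟨ha, mem_orthogonal_span_singleton.2 (halt a)⟩,
    fun u hu => halt.isRefl _ _ (mem_orthogonal_span_singleton.1 hu.2)⟩
  have hW' := hHTR.sup_span_of_odd halt
    (fun h => by simp [parity_simps] at hm; exact absurd h (by simpa using hm)) har hau
  refine ⟨⟨_, hW'.2⟩, ?_, le_sup_left, mem_sup_right (mem_span_singleton_self u)⟩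
  rw [or_iff_not_imp_left]
  intro hne
  exact adj_of_even halt hnd hm hne (by rw [TR.inf_eq hne hHd le_sup_left inf_le_left, hHd])

/-- The adjacency graph on regular subspaces of a fixed even dimension is connected. -/
theorem adj_connected_of_even (halt : ξ.IsAlt) (hnd : ξ.Nondegenerate) (hm : Even (m + 1))
    (P : TR ξ (m + 1) → Prop) (hP : ∀ X Y, Adj ξ (m + 1) X Y → P X → P Y) (X Y : TR ξ (m + 1))
    (hX : P X) : P Y := by
  -- `N` bounds the codimension of `X ⊓ Y` in `X`; the induction enlarges the intersection.
  obtain ⟨N, hN⟩ : ∃ N, m + 1 ≤ finrank F ↥(X.1 ⊓ Y.1) + N := ⟨m + 1, by omega⟩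
  induction N generalizing Y with
  | zero =>
    by_contra h
    have := TR.finrank_inf_le (fun e : X = Y => h (e ▸ hX))
    omega
  | succ N ih =>
    by_cases hXY : X = Y
    · exact hXY ▸ hX
    have hP' : ∀ {W W'}, (W = W' ∨ Adj ξ (m + 1) W W') → P W → P W' := by
      rintro W W' (rfl | h) hW
      exacts [hW, hP _ _ h hW]
    -- Exchanging along such an `a` keeps `X ⊓ W` and adds `u ∈ X`, so the intersection grows.
    have good : ∀ W : TR ξ (m + 1), finrank F ↥(X.1 ⊓ Y.1) ≤ finrank F ↥(X.1 ⊓ W.1) →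
        (∃ a ∈ W.1, a ∈ ξ.orthogonal (X.1 ⊓ W.1) ∧ ∃ u ∈ X.1, ξ a u ≠ 0) → P W := by
      rintro W hle ⟨a, haW, ha, u, hu, hau⟩
      obtain ⟨W', hWW', hW', huW'⟩ := W.exists_neighbour halt hnd hm haW hau
      refine hP' hWW' (ih W' ?_)
      have h1 : u ∉ X.1 ⊓ W.1 := fun h => hau (halt.isRefl _ _ (ha u h))
      have h3 : X.1 ⊓ W.1 ≤ ξ.orthogonal (span F {a}) :=
        (le_orthogonal_comm halt).1 ((span_singleton_le_iff_mem _ _).2 ha)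
      have h2 : X.1 ⊓ W.1 ⊔ span F {u} ≤ X.1 ⊓ W'.1 :=
        sup_le (le_inf inf_le_left ((le_inf inf_le_right h3).trans hW'))
          ((span_singleton_le_iff_mem _ _).2 ⟨hu, huW'⟩)
      have := finrank_mono h2
      rw [finrank_sup_span_singleton h1] at this
      omega
    by_cases hg : ∃ a ∈ Y.1, a ∈ ξ.orthogonal (X.1 ⊓ Y.1) ∧ ∃ u ∈ X.1, ξ a u ≠ 0
    · exact good Y le_rfl hg
    push Not at hg
    set D := X.1 ⊓ Y.1 with hD
    have hDle : finrank F D ≤ m := TR.finrank_inf_le hXY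
    have h1 := finrank_add_finrank_orthogonal_eq hnd D
    have h2 := finrank_sup_add_finrank_inf_eq Y.1 (ξ.orthogonal D)
    have h3 := (Y.1 ⊔ ξ.orthogonal D).finrank_le
    rw [Y.finrank_eq] at h2
    obtain ⟨a, ⟨haY, haD⟩, ha0⟩ := exists_mem_ne_zero_of_ne_bot
      (fun h : Y.1 ⊓ ξ.orthogonal D = ⊥ => by rw [h, finrank_bot] at h2; omega)
    have haX := hg a haY haD
    have haD' : a ∉ D := fun h => ha0 <| isRegular_iff.1 (X.2.2.1 hm) a h.1 fun u hu =>
      halt.isRefl _ _ (haX u hu)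
    -- When no vector of `Y ⊓ Dᗮ` pairs with `X`, a preliminary move brings in `x ∈ Dᗮ` not
    -- orthogonal to `X`, keeping `D`. Either the intersection already grows, or `x` makes the new
    -- space good.
    obtain ⟨x, hxD, hxX, hxa⟩ := exists_mem_notMem_notMem
      (B := ξ.orthogonal D) (Z := ξ.orthogonal X.1) (W := ξ.orthogonal (span F {a}))
      (fun h => hXY (TR.eq_of_le
        (((orthogonal_le_orthogonal_iff halt hnd).1 h).trans inf_le_right)))
      (fun h => haD' ((span_singleton_le_iff_mem _ _).1
        ((orthogonal_le_orthogonal_iff halt hnd).1 h)))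
    rw [mem_orthogonal_span_singleton] at hxa
    obtain ⟨W, hWY, hW, hxW⟩ := Y.exists_neighbour halt hnd hm haY hxa
    have h3 : D ≤ ξ.orthogonal (span F {a}) :=
      (le_orthogonal_comm halt).1 ((span_singleton_le_iff_mem _ _).2 haD)
    have hDW : D ≤ X.1 ⊓ W.1 := le_inf inf_le_left ((le_inf inf_le_right h3).trans hW)
    refine hP' hWY ?_
    rcases hDW.eq_or_lt with e | hlt
    · refine good W (finrank_mono hDW) ⟨x, hxW, e ▸ hxD, ?_⟩
      by_contra! hc
      exact hxX fun u hu => halt.isRefl _ _ (hc u hu)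
    · refine ih W ?_
      have := finrank_lt_finrank_of_lt hlt
      omega

/-- Any two elements of `(T-R)_m` are connected by a chain in which neighbours lie in a common
element of `(T-R)_{m+1}`. -/
theorem connected_of_common_ge (halt : ξ.IsAlt) (hnd : ξ.Nondegenerate) (hm : m < finrank F V)
    (P : TR ξ m → Prop)
    (hP : ∀ (H H' : TR ξ m) (X : TR ξ (m + 1)), H.1 ≤ X.1 → H'.1 ≤ X.1 → P H → P H')
    (H H' : TR ξ m) (h : P H) : P H' := by
  by_cases he : Even m
  · obtain _ | l := m
    · have : H = H' := Subtype.ext (by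
        rw [finrank_eq_zero.1 H.2.1, finrank_eq_zero.1 H'.2.1])
      exact this ▸ h
    · refine adj_connected_of_even halt hnd he P (fun X Y hXY => ?_) H H' h
      exact hP X Y ⟨_, (adj_iff.1 hXY).2.2⟩ le_sup_left le_sup_right
  · obtain ⟨X, hX⟩ := H.2.exists_ge halt hnd hm
    obtain ⟨X', hX'⟩ := H'.2.exists_ge halt hnd hm
    refine adj_connected_of_even halt hnd (by simpa [parity_simps] using he)
      (fun X => ∀ H : TR ξ m, H.1 ≤ X.1 → P H) (fun X Y hXY hQ K hK => ?_) X X'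
      (fun K hK => hP H K X hX hK h) H' hX'
    have h1 := (adj_iff.1 hXY).2.1
    exact hP ⟨_, h1⟩ K Y inf_le_right hK (hQ ⟨_, h1⟩ inf_le_left)

end Connectivity

end SymplecticGrassmann

namespace SymplecticGrassmann

open Module Submodule

set_option linter.unusedSectionVars false

variable {F V : Type*} [Field F] [AddCommGroup V] [Module F V] {ξ : LinearMap.BilinForm F V}
  [FiniteDimensional F V] {m m' : ℕ}

/-! ### Adjacency expressed by incidence with the next level -/

section Joined

/-- Both are contained in an element of `(T-R)` of the next dimension. -/
def Joined (ξ : LinearMap.BilinForm F V) (k : ℕ) (H K : TR ξ k) : Prop :=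
  ∃ X : TR ξ (k + 1), H.1 ≤ X.1 ∧ K.1 ≤ X.1

/-- The adjacency of tangential subspaces in terms of their incidence with the regular subspaces of
the next dimension. -/
def TangentialAdj (ξ : LinearMap.BilinForm F V) (k : ℕ) (H K : TR ξ k) : Prop :=
  H ≠ K ∧ Joined ξ k H K ∧ ∃ A B C : TR ξ k,
    (∀ D, D = A ∨ D = B ∨ D = C → Joined ξ k D H ∧ Joined ξ k D K ∧
      ¬ ∃ X : TR ξ (k + 1), H.1 ≤ X.1 ∧ K.1 ≤ X.1 ∧ D.1 ≤ X.1) ∧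
    ¬ Joined ξ k A B ∧ ¬ Joined ξ k B C ∧ Joined ξ k A C ∧ A ≠ C

theorem Joined.isTR_sup {H K : TR ξ (m + 1)} (h : Joined ξ (m + 1) H K) (hne : H ≠ K) :
    IsTR ξ (m + 2) (H.1 ⊔ K.1) := by
  obtain ⟨X, hH, hK⟩ := h
  rw [TR.sup_eq hne X.finrank_eq hH hK]
  exact X.2

theorem joined_of_isTR_sup {H K : TR ξ (m + 1)} (h : IsTR ξ (m + 2) (H.1 ⊔ K.1)) :
    Joined ξ (m + 1) H K :=
  ⟨⟨_, h⟩, le_sup_left, le_sup_right⟩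

theorem adj_iff_joined_of_even (halt : ξ.IsAlt) (hnd : ξ.Nondegenerate) (hm : Even (m + 1))
    {H K : TR ξ (m + 1)} : Adj ξ (m + 1) H K ↔ H ≠ K ∧ Joined ξ (m + 1) H K := by
  refine ⟨fun h => ⟨h.1, joined_of_isTR_sup (adj_iff.1 h).2.2⟩, fun ⟨hne, h⟩ => ?_⟩
  have h1 := (h.isTR_sup hne).1
  have h2 := H.finrank_sup_add K
  exact adj_of_even halt hnd hm hne (by omega)

/-- If the radical line of `K` were not in `G`, it would complement `G` in `K`; then the radical of
`G` would lie in that line and vanish. -/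
theorem rad_le_of_not_isRegular (halt : ξ.IsAlt) {G K : Submodule F V} (hG : ¬ IsRegular ξ G)
    (hK : IsTangential ξ K) (hGK : G ≤ K) (hd : finrank F K = finrank F G + 1) :
    rad ξ K ≤ G := by
  obtain ⟨r, hr0, hr, hspan⟩ := hK.exists_mem_rad
  have hrG : r ∈ G := by
    by_contra hrG
    apply hG
    have e : G ⊔ span F {r} = K := eq_of_le_of_finrank_eq
      (sup_le hGK ((span_singleton_le_iff_mem _ _).2 hr.1))
      (by rw [finrank_sup_span_singleton hrG, hd])
    rw [isRegular_iff]
    intro x hx hu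
    obtain ⟨c, rfl⟩ := hspan x ⟨hGK hx, fun u huK => by
      rw [← e] at huK
      obtain ⟨g, hg, c, rfl⟩ := mem_sup_span_singleton.1 huK
      simp [hu g hg, halt.isRefl _ _ (hr.2 x (hGK hx))]⟩
    by_cases hc : c = 0
    · simp [hc]
    · exact absurd ((G.smul_mem_iff hc).1 hx) hrG
  intro x hx
  obtain ⟨c, rfl⟩ := hspan x hx
  exact G.smul_mem c hrG

/-- With different radicals the join would be regular. A nonzero `z` in its radical spans both
radicals if `z ∈ H`; otherwise `H ⊔ K = H ⊔ ⟨z⟩`, and the radical of `H`, contained in `G ≤ K`, is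
orthogonal to all of `K`. -/
theorem rad_eq_of_not_joined (halt : ξ.IsAlt) (hm : ¬ Even (m + 1)) {G : Submodule F V}
    (hG : ¬ IsRegular ξ G) (hGd : finrank F G = m) {H K : TR ξ (m + 1)} (hne : H ≠ K)
    (hH : G ≤ H.1) (hK : G ≤ K.1) (h : ¬ Joined ξ (m + 1) H K) : rad ξ H.1 = rad ξ K.1 := by
  by_contra hrad
  have hHr := rad_le_of_not_isRegular halt hG (H.2.2.2 hm) hH (by rw [H.finrank_eq, hGd])
  have dH : finrank F (rad ξ H.1) = 1 := H.2.2.2 hm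
  have dK : finrank F (rad ξ K.1) = 1 := K.2.2.2 hm
  have hd : finrank F ↥(H.1 ⊔ K.1) = m + 2 := by
    have h1 := H.finrank_sup_add K
    rw [TR.inf_eq hne hGd hH hK, hGd] at h1
    omega
  refine h (joined_of_isTR_sup ⟨hd, fun _ => isRegular_iff.2 fun z hz hu => ?_,
    fun h => absurd (by simpa [parity_simps] using hm) h⟩)
  have hz1 : ∀ u ∈ H.1, ξ u z = 0 := fun u hu' => hu u (mem_sup_left hu')
  have hz2 : ∀ u ∈ K.1, ξ u z = 0 := fun u hu' => hu u (mem_sup_right hu')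
  by_cases hzH : z ∈ H.1
  · by_contra hz0
    have hzr : z ∈ rad ξ H.1 := ⟨hzH, hz1⟩
    have hzr' : z ∈ rad ξ K.1 := ⟨hK (hHr hzr), hz2⟩
    have hle : span F {z} ≤ rad ξ H.1 := (span_singleton_le_iff_mem _ _).2 hzr
    have hle' : span F {z} ≤ rad ξ K.1 := (span_singleton_le_iff_mem _ _).2 hzr'
    apply hrad
    rw [← eq_of_le_of_finrank_eq hle (by rw [finrank_span_singleton hz0, dH]),
      ← eq_of_le_of_finrank_eq hle' (by rw [finrank_span_singleton hz0, dK])]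
  · exfalso
    have e : H.1 ⊔ span F {z} = H.1 ⊔ K.1 := eq_of_le_of_finrank_eq
      (sup_le le_sup_left ((span_singleton_le_iff_mem _ _).2 hz))
      (by rw [finrank_sup_span_singleton hzH, hd, H.finrank_eq])
    refine hrad (eq_of_le_of_finrank_eq (fun r hr => ⟨hK (hHr hr), fun u hu' => ?_⟩) (by rw [dH, dK]))
    have hu2 : u ∈ H.1 ⊔ span F {z} := e ▸ mem_sup_right hu'
    obtain ⟨w, hw, c, rfl⟩ := mem_sup_span_singleton.1 hu2
    have h1 : ξ z r = 0 := halt.isRefl _ _ (hz1 r hr.1)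
    have h2 : ξ w r = 0 := hr.2 w hw
    simp [h1, h2]

theorem Joined.rad_ne (hm : ¬ Even (m + 1)) {H K : TR ξ (m + 1)} (h : Joined ξ (m + 1) H K)
    (hne : H ≠ K) : rad ξ H.1 ≠ rad ξ K.1 := by
  intro e
  obtain ⟨r, hr0, hr, -⟩ := (H.2.2.2 hm).exists_mem_rad
  have hr' : r ∈ rad ξ K.1 := e ▸ hr
  have hreg := isRegular_iff.1
    ((h.isTR_sup hne).2.1 (by simpa [parity_simps] using hm))
  refine hr0 (hreg r (mem_sup_left hr.1) fun u hu => ?_)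
  obtain ⟨a, ha, b, hb, rfl⟩ := mem_sup.1 hu
  have h1 : ξ a r = 0 := hr.2 a ha
  have h2 : ξ b r = 0 := hr'.2 b hb
  simp [h1, h2]

/-- The three witnesses all contain `H ⊓ K`. Were it not regular, the two unjoined pairs would give
`A`, `B`, `C` a common radical, whereas the distinct joined `A` and `C` have different radicals. -/
theorem adj_of_tangentialAdj (halt : ξ.IsAlt) (hm : ¬ Even (m + 1))
    {H K : TR ξ (m + 1)} (h : TangentialAdj ξ (m + 1) H K) : Adj ξ (m + 1) H K := by
  obtain ⟨hne, hJ, A, B, C, hD, hAB, hBC, hAC, hne'⟩ := h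
  have hsup := hJ.isTR_sup hne
  have hnear : Near ξ m H K := ⟨hne, Or.inr hsup⟩
  rw [adj_iff]
  refine ⟨hne, ⟨hnear.finrank_inf, fun _ => ?_,
    fun h => absurd (by simpa [parity_simps] using hm) h⟩, hsup⟩
  by_contra hG
  have key : ∀ D, D = A ∨ D = B ∨ D = C → H.1 ⊓ K.1 ≤ D.1 := by
    intro D hD'
    obtain ⟨h1, h2, h3⟩ := hD D hD'
    obtain ⟨X, hHX, hKX⟩ := id hJ
    have n1 : D ≠ H := fun e => h3 ⟨X, hHX, hKX, e ▸ hHX⟩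
    have n2 : D ≠ K := fun e => h3 ⟨X, hHX, hKX, e ▸ hKX⟩
    exact (inf_le_or_le_sup_of_near hnear ⟨n1, Or.inr (h1.isTR_sup n1)⟩
      ⟨n2, Or.inr (h2.isTR_sup n2)⟩).resolve_right
      fun hle => h3 ⟨⟨_, hsup⟩, le_sup_left, le_sup_right, hle⟩
  have n1 : A ≠ B := fun e => hBC (e ▸ hAC)
  have n2 : B ≠ C := fun e => hAB (e ▸ hAC)
  have e1 := rad_eq_of_not_joined halt hm hG hnear.finrank_inf n1 (key A (by simp))
    (key B (by simp)) hAB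
  have e2 := rad_eq_of_not_joined halt hm hG hnear.finrank_inf n2 (key B (by simp))
    (key C (by simp)) hBC
  exact hAC.rad_ne hm hne' (e1.trans e2)

/-- The witnesses are points of `Gᗮ` for the regular meet `G`, where being joined means pairing
nontrivially. They require a hyperbolic pair `g`, `k` orthogonal to the join, available because `m +
2 < dim V`. -/
theorem tangentialAdj_of_adj (h2 : (2 : F) ≠ 0) (halt : ξ.IsAlt) (hnd : ξ.Nondegenerate)
    (hm : ¬ Even (m + 1)) (hmn : m + 2 < finrank F V) {H K : TR ξ (m + 1)}
    (h : Adj ξ (m + 1) H K) : TangentialAdj ξ (m + 1) H K := by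
  have hme : Even m := by simpa [parity_simps] using hm
  have hme2 : Even (m + 2) := hme.add even_two
  have hadj := adj_iff.1 h
  obtain ⟨hne, hG, hB⟩ := hadj
  set G := H.1 ⊓ K.1 with hGdef
  set B := H.1 ⊔ K.1 with hBdef
  obtain ⟨e, he, he0, hH⟩ := hG.exists_span hnd hme H.finrank_eq inf_le_left
  obtain ⟨f, hf, hf0, hK⟩ := hG.exists_span hnd hme K.finrank_eq inf_le_right
  have hef := (adj_iff_of_span halt hme hG he hf hH hK).1 h
  obtain ⟨f, hf, hef, hK⟩ : ∃ f' ∈ ξ.orthogonal G, ξ e f' = 1 ∧ K.1 = G ⊔ span F {f'} := by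
    refine ⟨(ξ e f)⁻¹ • f, smul_mem _ _ hf, by simp [hef], ?_⟩
    rw [span_singleton_smul_eq (IsUnit.mk0 _ (inv_ne_zero hef)), hK]
  have hBd := finrank_add_finrank_orthogonal_eq hnd B
  rw [hB.1] at hBd
  have hBreg := hB.2.1 hme2
  obtain ⟨g, hg, hg0⟩ := exists_mem_ne_zero_of_ne_bot
    (fun h : ξ.orthogonal B = ⊥ => by rw [h, finrank_bot] at hBd; omega)
  obtain ⟨k, hk, hgk⟩ := hBreg.exists_orthogonal_ne halt hnd hg hg0
  obtain ⟨k, hk, hgk⟩ : ∃ k ∈ ξ.orthogonal B, ξ g k = 1 :=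
    ⟨(ξ g k)⁻¹ • k, smul_mem _ _ hk, by simp [hgk]⟩
  have hGB : G ≤ B := inf_le_left.trans le_sup_left
  have hk0 : k ≠ 0 := by rintro rfl; simp at hgk
  have heB : e ∈ B := mem_sup_left (by rw [hH]; exact mem_sup_right (mem_span_singleton_self e))
  have hfB : f ∈ B := mem_sup_right (by rw [hK]; exact mem_sup_right (mem_span_singleton_self f))
  have hgG : g ∈ ξ.orthogonal G := LinearMap.BilinForm.orthogonal_le hGB hg
  have hkG : k ∈ ξ.orthogonal G := LinearMap.BilinForm.orthogonal_le hGB hk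
  have eg : ξ e g = 0 := hg e heB
  have ek : ξ e k = 0 := hk e heB
  have fg : ξ f g = 0 := hg f hfB
  have fk : ξ f k = 0 := hk f hfB
  have ge : ξ g e = 0 := halt.isRefl _ _ eg
  have ke : ξ k e = 0 := halt.isRefl _ _ ek
  have gf : ξ g f = 0 := halt.isRefl _ _ fg
  have kf : ξ k f = 0 := halt.isRefl _ _ fk
  have fe : ξ f e = -1 := by rw [← halt.neg_eq, hef]
  have kg : ξ k g = -1 := by rw [← halt.neg_eq, hgk]
  have ee := halt e
  have ff := halt f
  have gg := halt g
  have kk := halt k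
  have hf0 : f ≠ 0 := by rintro rfl; simp at hef
  have ne0 : ∀ w, ξ f w = -1 → w ≠ 0 := by rintro w hw rfl; simp at hw
  -- With `ξ e f = ξ g k = 1` these satisfy `ξ a b = ξ b c = 0` and `ξ a c = -1`. Their parts `2g`,
  -- `g`, `-k` keep them outside the join, and `ξ e c = 2`.
  let a := e + f + (2 : F) • g
  let b := e + f + g
  let c := e + (2 : F) • f - k
  have ha : a ∈ ξ.orthogonal G := add_mem (add_mem he hf) (smul_mem _ _ hgG)
  have hb : b ∈ ξ.orthogonal G := add_mem (add_mem he hf) hgG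
  have hc : c ∈ ξ.orthogonal G := sub_mem (add_mem he (smul_mem _ _ hf)) hkG
  have fa : ξ f a = -1 := by simp [a, fe, ff, fg]
  have fb : ξ f b = -1 := by simp [b, fe, ff, fg]
  have fc : ξ f c = -1 := by simp [c, fe, ff, fk]
  let pt : {w // w ∈ ξ.orthogonal G ∧ w ≠ 0} → TR ξ (m + 1) :=
    fun w => ⟨_, hG.sup_span halt hnd hme w.2.1 w.2.2⟩
  have hpt : ∀ w w', Adj ξ (m + 1) (pt w) (pt w') ↔ ξ w.1 w'.1 ≠ 0 :=
    fun w w' => adj_iff_of_span halt hme hG w.2.1 w'.2.1 rfl rfl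
  have hJ : ∀ w w', ξ w.1 w'.1 ≠ 0 → Joined ξ (m + 1) (pt w) (pt w') := fun w w' hw =>
    joined_of_isTR_sup (adj_iff.1 ((hpt w w').2 hw)).2.2
  have hnJ : ∀ w w', ξ w.1 w'.1 = 0 → pt w ≠ pt w' → ¬ Joined ξ (m + 1) (pt w) (pt w') := by
    intro w w' h0 hne hJ'
    refine (hpt w w').1 (adj_iff.2 ⟨hne, ?_, hJ'.isTR_sup hne⟩) h0
    rw [TR.inf_eq hne hG.1 le_sup_left le_sup_left]
    exact hG
  have hmem : ∀ w, w.1 ∈ (pt w).1 := fun w => mem_sup_right (mem_span_singleton_self _)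
  -- two points with the same pairing with `f` are distinct unless they differ by an element of `G`
  have hdiff : ∀ w w', ξ f w.1 = -1 → ξ f w'.1 = -1 → pt w = pt w' → w.1 - w'.1 ∈ G := by
    intro w w' h1 h3 e1
    have h4 : w.1 ∈ G ⊔ span F {w'.1} := by
      have := hmem w
      rw [e1] at this
      exact this
    obtain ⟨x, hx, d, hd⟩ := mem_sup_span_singleton.1 h4
    have hfx : ξ f x = 0 := halt.isRefl _ _ (hf x hx)
    have h5 := congrArg (ξ f) hd
    simp only [map_add, map_smul, hfx, h1, h3, smul_eq_mul] at h5
    have hd1 : d = 1 := by linear_combination h5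
    rw [hd, hd1]
    simpa using hx
  have hHe : H = pt ⟨e, he, he0⟩ := Subtype.ext hH
  have hKf : K = pt ⟨f, hf, hf0⟩ := Subtype.ext hK
  have notB : ∀ w z, z ∈ ξ.orthogonal B → z ≠ 0 → w.1 - z ∈ B →
      ¬ ∃ X : TR ξ (m + 1 + 1), H.1 ≤ X.1 ∧ K.1 ≤ X.1 ∧ (pt w).1 ≤ X.1 := by
    rintro w z hz hz0 hwz ⟨X, hHX, hKX, hwX⟩
    have hXB : B = X.1 := TR.sup_eq hne X.finrank_eq hHX hKX
    have hwB : w.1 ∈ B := hXB ▸ hwX (hmem w)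
    exact hBreg.notMem hz hz0 (by simpa using sub_mem hwB hwz)
  refine ⟨hne, joined_of_isTR_sup hB, pt ⟨a, ha, ne0 _ fa⟩, pt ⟨b, hb, ne0 _ fb⟩,
    pt ⟨c, hc, ne0 _ fc⟩, ?_, ?_, ?_, ?_, ?_⟩
  · rintro D (rfl | rfl | rfl)
    · refine ⟨hHe ▸ hJ _ _ ?_, hKf ▸ hJ _ _ ?_, notB _ ((2 : F) • g) (smul_mem _ _ hg) ?_ ?_⟩
      · simp [a, ee, fe, ge]
      · simp [a, hef, ff, gf]
      · exact smul_ne_zero h2 hg0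
      · simpa [a] using add_mem heB hfB
    · refine ⟨hHe ▸ hJ _ _ ?_, hKf ▸ hJ _ _ ?_, notB _ g hg hg0 ?_⟩
      · simp [b, ee, fe, ge]
      · simp [b, hef, ff, gf]
      · simpa [b] using add_mem heB hfB
    · refine ⟨hHe ▸ hJ _ _ ?_, hKf ▸ hJ _ _ ?_, notB _ (-k) (neg_mem hk) (neg_ne_zero.2 hk0) ?_⟩
      · simp [c, ee, fe, ke, h2]
      · simp [c, hef, ff, kf]
      · simpa [c] using add_mem heB (smul_mem _ (2 : F) hfB)
  · refine hnJ _ _ (by simp [a, b, hef, fe, eg, fg, ge, gf, ee, ff, gg]) fun e1 => ?_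
    have h3 := hdiff _ _ fa fb e1
    have h4 : a - b = g := by simp only [a, b]; module
    exact hBreg.notMem hg hg0 (hGB (h4 ▸ h3))
  · refine hnJ _ _ ?_ fun e1 => ?_
    · simp [b, c, hef, fe, ek, fk, ge, gf, ee, ff, hgk]
      ring
    · have h3 := hdiff _ _ fb fc e1
      have h4 : ξ e (b - c) = 0 := halt.isRefl _ _ (he _ h3)
      simp only [b, c, map_add, map_sub, map_smul, ee, hef, eg, ek, smul_eq_mul] at h4
      apply one_ne_zero (α := F)
      linear_combination -h4
  · refine hJ _ _ ?_
    simp [a, c, hef, fe, ek, fk, ge, gf, ee, ff, hgk]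
  · refine ((hpt _ _).2 ?_).1
    simp [a, c, hef, fe, ek, fk, ge, gf, ee, ff, hgk]

theorem Joined.map {k k' : ℕ} {h : TR ξ k ≃ TR ξ k'} {f : TR ξ (k + 1) ≃ TR ξ (k' + 1)}
    (hf : ∀ H X, (h H).1 ≤ (f X).1 ↔ H.1 ≤ X.1) {H K : TR ξ k} :
    Joined ξ k' (h H) (h K) ↔ Joined ξ k H K := by
  constructor
  · rintro ⟨X, h1, h2⟩
    refine ⟨f.symm X, ?_, ?_⟩ <;> rw [← hf, f.apply_symm_apply] <;> assumption
  · rintro ⟨X, h1, h2⟩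
    exact ⟨f X, (hf _ _).2 h1, (hf _ _).2 h2⟩

theorem TangentialAdj.map {k k' : ℕ} {h : TR ξ k ≃ TR ξ k'} {f : TR ξ (k + 1) ≃ TR ξ (k' + 1)}
    (hf : ∀ H X, (h H).1 ≤ (f X).1 ↔ H.1 ≤ X.1) {H K : TR ξ k} (hHK : TangentialAdj ξ k H K) :
    TangentialAdj ξ k' (h H) (h K) := by
  obtain ⟨hne, hJ, A, B, C, hD, hAB, hBC, hAC, hne'⟩ := hHK
  refine ⟨h.injective.ne hne, (Joined.map hf).2 hJ, h A, h B, h C, ?_, ?_, ?_, ?_,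
    h.injective.ne hne'⟩
  · have key : ∀ D, D = A ∨ D = B ∨ D = C → Joined ξ k' (h D) (h H) ∧ Joined ξ k' (h D) (h K) ∧
        ¬ ∃ X : TR ξ (k' + 1), (h H).1 ≤ X.1 ∧ (h K).1 ≤ X.1 ∧ (h D).1 ≤ X.1 := by
      intro D hD'
      obtain ⟨h1, h2, h3⟩ := hD D hD'
      refine ⟨(Joined.map hf).2 h1, (Joined.map hf).2 h2, ?_⟩
      rintro ⟨X, hX⟩
      apply h3
      refine ⟨f.symm X, ?_⟩
      rw [← hf, ← hf, ← hf, f.apply_symm_apply]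
      exact hX
    rintro D (rfl | rfl | rfl) <;> exact key _ (by simp)
  all_goals rwa [Joined.map hf]

/-- A bijection compatible with the incidence to the next dimension preserves the adjacency. -/
theorem adj_map_iff_of_incidence (h2 : (2 : F) ≠ 0) (halt : ξ.IsAlt) (hnd : ξ.Nondegenerate)
    (hmm : Even m ↔ Even m') (hm : m + 2 < finrank F V) (hm' : m' + 2 < finrank F V)
    {h : TR ξ (m + 1) ≃ TR ξ (m' + 1)} {f : TR ξ (m + 2) ≃ TR ξ (m' + 2)}
    (hf : ∀ H X, (h H).1 ≤ (f X).1 ↔ H.1 ≤ X.1) (H K : TR ξ (m + 1)) :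
    Adj ξ (m' + 1) (h H) (h K) ↔ Adj ξ (m + 1) H K := by
  by_cases he : Even (m + 1)
  · have he' : Even (m' + 1) := by
      rw [Nat.even_add_one, ← hmm, ← Nat.even_add_one]
      exact he
    rw [adj_iff_joined_of_even halt hnd he, adj_iff_joined_of_even halt hnd he',
      h.injective.ne_iff]
    exact and_congr_right fun _ => Joined.map hf
  · have he' : ¬ Even (m' + 1) := by
      rw [Nat.even_add_one, ← hmm, ← Nat.even_add_one]
      exact he
    have hf' : ∀ H X, (h.symm H).1 ≤ (f.symm X).1 ↔ H.1 ≤ X.1 := fun H X => by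
      rw [← hf, h.apply_symm_apply, f.apply_symm_apply]
    constructor
    · intro hadj
      have := (tangentialAdj_of_adj h2 halt hnd he' hm' hadj).map hf'
      simpa using adj_of_tangentialAdj halt he this
    · exact fun hadj =>
        adj_of_tangentialAdj halt he' ((tangentialAdj_of_adj h2 halt hnd he hm hadj).map hf)

end Joined

end SymplecticGrassmann

namespace SymplecticGrassmann

open Module Submodule

set_option linter.unusedSectionVars false

variable {F V : Type*} [Field F] [AddCommGroup V] [Module F V] {ξ : LinearMap.BilinForm F V}
  [FiniteDimensional F V]

/-! ### From permutations of points to lattice automorphisms -/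

section Points

theorem conj_iff {U W : Submodule F V} : Conj ξ U W ↔ W ≤ ξ.orthogonal U :=
  ⟨fun h w hw u hu => h u hu w hw, fun h u hu _ hw => h hw u hu⟩

theorem le_of_points {A B : Submodule F V} (h : ∀ p : Sub F V 1, p.1 ≤ A → p.1 ≤ B) : A ≤ B := by
  intro x hx
  by_cases hx0 : x = 0
  · exact hx0 ▸ B.zero_mem
  · exact h ⟨span F {x}, finrank_span_singleton hx0⟩ ((span_singleton_le_iff_mem _ _).2 hx)
      (mem_span_singleton_self x)

theorem Sub.eq_of_le {p q : Sub F V 1} (h : p.1 ≤ q.1) : p = q :=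
  Subtype.ext (eq_of_le_of_finrank_eq h (by rw [p.2, q.2]))

/-- The span of the images of the points of a subspace. -/
def pointsMap (σ : Equiv.Perm (Sub F V 1)) (W : Submodule F V) : Submodule F V :=
  ⨆ p : {p : Sub F V 1 // p.1 ≤ W}, (σ p.1).1

theorem pointsMap_le {σ : Equiv.Perm (Sub F V 1)} {W U : Submodule F V} :
    pointsMap σ W ≤ U ↔ ∀ p : Sub F V 1, p.1 ≤ W → (σ p).1 ≤ U := by
  rw [pointsMap, iSup_le_iff, Subtype.forall]

/-- If `σ p` lies in the span of the image of `W`, it is orthogonal to `σ r` for every point `r` of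
`Wᗮ`. Hence `p` is orthogonal to `Wᗮ`, that is, `p ≤ W`. -/
theorem le_pointsMap_iff (halt : ξ.IsAlt) (hnd : ξ.Nondegenerate) {σ : Equiv.Perm (Sub F V 1)}
    (hσ : ∀ p q, Conj ξ (σ p).1 (σ q).1 ↔ Conj ξ p.1 q.1) {p : Sub F V 1} {W : Submodule F V} :
    (σ p).1 ≤ pointsMap σ W ↔ p.1 ≤ W := by
  refine ⟨fun h => ?_, fun h => pointsMap_le.1 le_rfl p h⟩
  rw [← orthogonal_orthogonal_eq halt hnd W, le_orthogonal_comm halt]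
  refine le_of_points fun r hr => ?_
  rw [le_orthogonal_comm halt, ← conj_iff, ← hσ, conj_iff]
  refine h.trans (pointsMap_le.2 fun q hq => ?_)
  rw [← conj_iff, hσ, conj_iff]
  exact hq.trans ((le_orthogonal_comm halt).1 hr)

theorem exists_orderIso_of_conj (halt : ξ.IsAlt) (hnd : ξ.Nondegenerate)
    (σ : Equiv.Perm (Sub F V 1)) (hσ : ∀ p q, Conj ξ (σ p).1 (σ q).1 ↔ Conj ξ p.1 q.1) :
    ∃ Φ : Submodule F V ≃o Submodule F V, (∀ U, Φ (ξ.orthogonal U) = ξ.orthogonal (Φ U)) ∧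
      ∀ p : Sub F V 1, Φ p.1 = (σ p).1 := by
  have hσ' : ∀ p q, Conj ξ (σ.symm p).1 (σ.symm q).1 ↔ Conj ξ p.1 q.1 := fun p q => by
    rw [← hσ, σ.apply_symm_apply, σ.apply_symm_apply]
  have key := @le_pointsMap_iff _ _ _ _ _ _ _ halt hnd σ hσ
  have key' := @le_pointsMap_iff _ _ _ _ _ _ _ halt hnd σ.symm hσ'
  have hmono : ∀ A B, pointsMap σ A ≤ pointsMap σ B ↔ A ≤ B := fun A B =>
    ⟨fun h => le_of_points fun p hp => key.1 ((key.2 hp).trans h),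
      fun h => pointsMap_le.2 fun p hp => key.2 (hp.trans h)⟩
  have hleft : ∀ W, pointsMap σ.symm (pointsMap σ W) = W := fun W => le_antisymm
    (pointsMap_le.2 fun p hp => key.1 (by rwa [σ.apply_symm_apply]))
    (le_of_points fun p hp => by
      rw [← σ.symm_apply_apply p, key']
      exact key.2 hp)
  have hright : ∀ W, pointsMap σ (pointsMap σ.symm W) = W := fun W => le_antisymm
    (pointsMap_le.2 fun p hp => key'.1 (by rwa [σ.symm_apply_apply]))
    (le_of_points fun p hp => by
      rw [← σ.apply_symm_apply p, key]
      exact key'.2 hp)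
  refine ⟨⟨⟨pointsMap σ, pointsMap σ.symm, hleft, hright⟩, @fun A B => hmono A B⟩,
    fun U => ?_, fun p => ?_⟩
  · change pointsMap σ _ = ξ.orthogonal (pointsMap σ U)
    have h : ∀ q : Sub F V 1, (σ q).1 ≤ ξ.orthogonal (pointsMap σ U) ↔ q.1 ≤ ξ.orthogonal U := by
      intro q
      rw [le_orthogonal_comm halt, pointsMap_le, le_orthogonal_comm halt]
      simp only [← conj_iff, hσ]
      exact ⟨fun h => conj_iff.2 (le_of_points fun p hp => conj_iff.1 (h p hp)),
        fun h p hp => conj_iff.2 (hp.trans (conj_iff.1 h))⟩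
    refine le_antisymm (pointsMap_le.2 fun q hq => (h q).2 hq) (le_of_points fun q hq => ?_)
    rw [← σ.apply_symm_apply q] at hq ⊢
    exact key.2 ((h _).1 hq)
  · change pointsMap σ p.1 = _
    refine le_antisymm (pointsMap_le.2 fun q hq => by rw [Sub.eq_of_le hq]) (key.2 le_rfl)

end Points

/-! ### Lattice automorphisms commuting with `⊥` -/

section OrderIso

variable {Φ : Submodule F V ≃o Submodule F V}

/-- Dimension is lattice-theoretic: it is the length, which is the height in the lattice of
subspaces. -/
theorem finrank_orderIso (Φ : Submodule F V ≃o Submodule F V) (U : Submodule F V) :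
    finrank F (Φ U) = finrank F U := by
  have h : Module.length F (Φ U) = Module.length F U := by
    rw [Module.length_submodule, Module.length_submodule, Order.height_orderIso]
  rw [Module.length_eq_finrank, Module.length_eq_finrank] at h
  exact_mod_cast h

variable (hΦ : ∀ U, Φ (ξ.orthogonal U) = ξ.orthogonal (Φ U))
include hΦ

theorem orthogonal_symm_orderIso (U : Submodule F V) :
    Φ.symm (ξ.orthogonal U) = ξ.orthogonal (Φ.symm U) := by
  rw [OrderIso.symm_apply_eq, hΦ, Φ.apply_symm_apply]

theorem rad_orderIso (U : Submodule F V) : rad ξ (Φ U) = Φ (rad ξ U) := by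
  rw [rad, rad, Φ.map_inf, hΦ]

theorem isTR_orderIso {k : ℕ} {U : Submodule F V} : IsTR ξ k (Φ U) ↔ IsTR ξ k U := by
  rw [IsTR, IsTR, IsRegular, IsTangential, rad_orderIso hΦ, finrank_orderIso, finrank_orderIso,
    map_eq_bot_iff, IsRegular, IsTangential]

/-- The bijection of `(T-R)_k` given by a lattice automorphism commuting with `⊥`. -/
def orderIsoTR (k : ℕ) : Equiv.Perm (TR ξ k) :=
  Φ.toEquiv.subtypeEquiv fun _ => (isTR_orderIso hΦ).symm

omit hΦ in
/-- The collineation given by a lattice automorphism. -/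
def orderIsoCollineation (Φ : Submodule F V ≃o Submodule F V) : Collineation F V where
  onPoints := Φ.toEquiv.subtypeEquiv fun U => by rw [← finrank_orderIso Φ U]; rfl
  onLines := Φ.toEquiv.subtypeEquiv fun U => by rw [← finrank_orderIso Φ U]; rfl
  incidence _ _ := Φ.le_iff_le

theorem preservesConj_orderIso : (orderIsoCollineation Φ).PreservesConj ξ := fun p q => by
  rw [conj_iff, conj_iff]
  change Φ q.1 ≤ ξ.orthogonal (Φ p.1) ↔ _
  rw [← hΦ, Φ.le_iff_le]

theorem image_pencil_orderIso (k : ℕ) (H B : Submodule F V) :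
    orderIsoTR hΦ k '' pencil ξ k H B = pencil ξ k (Φ H) (Φ B) := by
  ext U
  constructor
  · rintro ⟨W, hW, rfl⟩
    exact ⟨Φ.le_iff_le.2 hW.1, Φ.le_iff_le.2 hW.2⟩
  · intro hU
    refine ⟨(orderIsoTR hΦ k).symm U, ⟨?_, ?_⟩, Equiv.apply_symm_apply _ _⟩
    · exact Φ.le_symm_apply.2 hU.1
    · exact Φ.symm_apply_le.2 hU.2

theorem image_mem_pencils_orderIso {k : ℕ} {g : Set (TR ξ k)} (hg : g ∈ pencils ξ k) :
    orderIsoTR hΦ k '' g ∈ pencils ξ k := by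
  obtain ⟨hne, H, B, hH, hB, hHB, rfl⟩ := hg
  exact ⟨hne.image _, Φ H, Φ B, (isTR_orderIso hΦ).2 hH, (isTR_orderIso hΦ).2 hB,
    Φ.le_iff_le.2 hHB, image_pencil_orderIso hΦ k H B⟩

theorem orderIsoTR_mem_grassmannAutomorphisms (k : ℕ) :
    orderIsoTR hΦ k ∈ grassmannAutomorphisms ξ k := by
  refine fun g => ⟨fun h => ?_, image_mem_pencils_orderIso hΦ⟩
  have := image_mem_pencils_orderIso (orthogonal_symm_orderIso hΦ) h
  have e : orderIsoTR (orthogonal_symm_orderIso hΦ) k '' (orderIsoTR hΦ k '' g) = g :=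
    (orderIsoTR hΦ k).symm_image_image g
  rwa [e] at this

end OrderIso

/-! ### Induced bijections and the case of points -/

section Induced

theorem maps_orderIso (Φ : Submodule F V ≃o Submodule F V) (U : Submodule F V) :
    (orderIsoCollineation Φ).Maps U (Φ U) := fun _ => Φ.le_iff_le

theorem Collineation.exists_orderIso (halt : ξ.IsAlt) (hnd : ξ.Nondegenerate)
    {φ : Collineation F V} (hφ : φ.PreservesConj ξ) :
    ∃ Φ : Submodule F V ≃o Submodule F V, (∀ U, Φ (ξ.orthogonal U) = ξ.orthogonal (Φ U)) ∧
      ∀ U W, φ.Maps U W ↔ W = Φ U := by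
  obtain ⟨Φ, hΦ, hp⟩ := exists_orderIso_of_conj halt hnd φ.onPoints hφ
  refine ⟨Φ, hΦ, fun U W => ⟨fun h => ?_, ?_⟩⟩
  · have key : ∀ q : Sub F V 1, q.1 ≤ W ↔ q.1 ≤ Φ U := fun q => by
      have := h (φ.onPoints.symm q)
      rw [φ.onPoints.apply_symm_apply] at this
      rw [this, ← Φ.le_iff_le, hp, φ.onPoints.apply_symm_apply]
    exact le_antisymm (le_of_points fun q => (key q).1) (le_of_points fun q => (key q).2)
  · rintro rfl p
    rw [← hp, Φ.le_iff_le]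

theorem mem_inducedBijections (halt : ξ.IsAlt) (hnd : ξ.Nondegenerate) {k : ℕ}
    {f : Equiv.Perm (TR ξ k)} :
    f ∈ inducedBijections ξ k ↔ ∃ Φ : Submodule F V ≃o Submodule F V,
      (∀ U, Φ (ξ.orthogonal U) = ξ.orthogonal (Φ U)) ∧ ∀ U : TR ξ k, (f U).1 = Φ U.1 := by
  constructor
  · rintro ⟨φ, hφ, hf⟩
    obtain ⟨Φ, hΦ, hm⟩ := φ.exists_orderIso halt hnd hφ
    exact ⟨Φ, hΦ, fun U => (hm _ _).1 (hf U)⟩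
  · rintro ⟨Φ, hΦ, hf⟩
    exact ⟨_, preservesConj_orderIso hΦ, fun U => hf U ▸ maps_orderIso Φ U.1⟩

theorem inducedBijections_subset (halt : ξ.IsAlt) (hnd : ξ.Nondegenerate) (k : ℕ) :
    inducedBijections ξ k ⊆ grassmannAutomorphisms ξ k := by
  intro f hf
  obtain ⟨Φ, hΦ, h⟩ := (mem_inducedBijections halt hnd).1 hf
  have : f = orderIsoTR hΦ k := Equiv.ext fun U => Subtype.ext (h U)
  exact this ▸ orderIsoTR_mem_grassmannAutomorphisms hΦ k

theorem grassmannAutomorphisms_subset (k : ℕ) :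
    grassmannAutomorphisms ξ k ⊆ adjacencyBijections ξ k := by
  intro f hf U W
  refine and_congr f.injective.ne_iff ⟨?_, ?_⟩
  · rintro ⟨g, hg, hU, hW⟩
    refine ⟨f ⁻¹' g, (hf _).1 ?_, hU, hW⟩
    rwa [f.image_preimage]
  · rintro ⟨g, hg, hU, hW⟩
    exact ⟨f '' g, (hf g).2 hg, ⟨U, hU, rfl⟩, ⟨W, hW, rfl⟩⟩

theorem existsUnique_induced (halt : ξ.IsAlt) (hnd : ξ.Nondegenerate) (k : ℕ)
    {φ : Collineation F V} (hφ : φ.PreservesConj ξ) :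
    ∃! f : Equiv.Perm (TR ξ k), ∀ U : TR ξ k, φ.Maps U.1 (f U).1 := by
  obtain ⟨Φ, hΦ, hm⟩ := φ.exists_orderIso halt hnd hφ
  refine ⟨orderIsoTR hΦ k, fun U => (hm _ _).2 rfl, fun f hf => ?_⟩
  exact Equiv.ext fun U => Subtype.ext ((hm _ _).1 (hf U))

theorem isTR_one (halt : ξ.IsAlt) {U : Submodule F V} : IsTR ξ 1 U ↔ finrank F U = 1 := by
  refine ⟨fun h => h.1, fun h => ⟨h, fun h => absurd h (by simp), fun _ => ?_⟩⟩
  obtain ⟨x, -, hx⟩ := finrank_eq_one_iff'.1 h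
  have : rad ξ U = U := by
    refine inf_eq_left.2 fun y hy z hz => ?_
    obtain ⟨c, hc⟩ := hx ⟨y, hy⟩
    obtain ⟨d, hd⟩ := hx ⟨z, hz⟩
    have hc : c • x.1 = y := congrArg Subtype.val hc
    have hd : d • x.1 = z := congrArg Subtype.val hd
    rw [← hc, ← hd]
    simp [halt x.1]
  rw [IsTangential, this, h]

theorem isTR_bot : IsTR ξ 0 (⊥ : Submodule F V) :=
  ⟨finrank_bot F V, fun _ => by rw [IsRegular, rad, bot_inf_eq], fun h => absurd Even.zero h⟩

theorem adj_one_iff (halt : ξ.IsAlt) (hnd : ξ.Nondegenerate) {X Y : TR ξ 1} :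
    Adj ξ 1 X Y ↔ ¬ Conj ξ X.1 Y.1 := by
  obtain ⟨x, hx, -, hX⟩ := isTR_bot.exists_span (ξ := ξ) hnd Even.zero X.finrank_eq bot_le
  obtain ⟨y, hy, -, hY⟩ := isTR_bot.exists_span (ξ := ξ) hnd Even.zero Y.finrank_eq bot_le
  rw [show Adj ξ 1 X Y ↔ _ from adj_iff_of_span halt Even.zero isTR_bot hx hy hX hY, not_iff_not,
    conj_iff, hX, hY, bot_sup_eq, bot_sup_eq, span_singleton_le_iff_mem,
    mem_orthogonal_span_singleton]

theorem exists_orderIso_of_adj_one (halt : ξ.IsAlt) (hnd : ξ.Nondegenerate)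
    {f : TR ξ 1 ≃ TR ξ 1} (hf : ∀ X Y, Adj ξ 1 (f X) (f Y) ↔ Adj ξ 1 X Y) :
    ∃ Φ : Submodule F V ≃o Submodule F V, (∀ U, Φ (ξ.orthogonal U) = ξ.orthogonal (Φ U)) ∧
      ∀ U : TR ξ 1, (f U).1 = Φ U.1 := by
  let e : TR ξ 1 ≃ Sub F V 1 := Equiv.subtypeEquivRight fun _ => isTR_one halt
  obtain ⟨Φ, hΦ, h⟩ := exists_orderIso_of_conj halt hnd ((e.symm.trans f).trans e) fun p q => by
    have := hf (e.symm p) (e.symm q)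
    rw [adj_one_iff halt hnd, adj_one_iff halt hnd, not_iff_not] at this
    exact this
  exact ⟨Φ, hΦ, fun U => (h (e U)).symm⟩

end Induced

end SymplecticGrassmann

namespace SymplecticGrassmann

open Module Submodule

set_option linter.unusedSectionVars false

variable {F V : Type*} [Field F] [AddCommGroup V] [Module F V] {ξ : LinearMap.BilinForm F V}
  [FiniteDimensional F V] {m m' : ℕ}

/-! ### Action of graph isomorphisms on stars and tops -/

section StarsTops

/-- The bijection takes tops to tops. -/
def MapsTops (f : TR ξ (m + 1) ≃ TR ξ (m' + 1)) : Prop :=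
  ∀ B, IsTR ξ (m + 2) B → ∃ B', IsTR ξ (m' + 2) B' ∧ f '' top ξ m B = top ξ m' B'

/-- The bijection takes stars to stars. -/
def MapsStars (f : TR ξ (m + 1) ≃ TR ξ (m' + 1)) : Prop :=
  ∀ H, IsTR ξ m H → ∃ H', IsTR ξ m' H' ∧ f '' star ξ m H = star ξ m' H'

theorem IsBlock.image (h2 : (2 : F) ≠ 0) (halt : ξ.IsAlt) (hnd : ξ.Nondegenerate)
    {f : TR ξ (m + 1) ≃ TR ξ (m' + 1)}
    (hf : ∀ X Y, Adj ξ (m' + 1) (f X) (f Y) ↔ Adj ξ (m + 1) X Y) {C : Set (TR ξ (m + 1))}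
    (hC : IsBlock ξ m C) : IsBlock ξ m' (f '' C) := by
  rw [f.image_eq_preimage_symm]
  exact hC.preimage h2 halt hnd (adj_symm_iff hf)

variable {f : TR ξ (m + 1) ≃ TR ξ (m' + 1)}

/-- A star and a top through a common element cannot both be mapped to stars. -/
theorem not_image_star_star (halt : ξ.IsAlt) (hnd : ξ.Nondegenerate) (hm : m + 2 < finrank F V)
    {H B H' H'' : Submodule F V} (hH : IsTR ξ m H) (hB : IsTR ξ (m + 2) B) {X : TR ξ (m + 1)}
    (hHX : H ≤ X.1) (hXB : X.1 ≤ B) (hH' : IsTR ξ m' H') (hH'' : IsTR ξ m' H'')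
    (e1 : f '' star ξ m H = star ξ m' H') (e2 : f '' top ξ m B = star ξ m' H'') : False := by
  obtain ⟨W, hW, hWB, hne⟩ := exists_ne_mem_star_top halt hnd hH hB hHX hXB
  have e := eq_of_mem_star hH' hH'' (f.injective.ne hne) (e1 ▸ Set.mem_image_of_mem f hHX)
    (e1 ▸ Set.mem_image_of_mem f hW) (e2 ▸ Set.mem_image_of_mem f hXB)
    (e2 ▸ Set.mem_image_of_mem f hWB)
  refine star_ne_top halt hnd hm hH hB.1 (f.injective.image_injective ?_)
  change f '' _ = f '' _
  rw [e1, e2, e]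

/-- A star and a top through a common element cannot both be mapped to tops. -/
theorem not_image_top_top (halt : ξ.IsAlt) (hnd : ξ.Nondegenerate) (hm : m + 2 < finrank F V)
    {H B B' B'' : Submodule F V} (hH : IsTR ξ m H) (hB : IsTR ξ (m + 2) B) {X : TR ξ (m + 1)}
    (hHX : H ≤ X.1) (hXB : X.1 ≤ B) (hB' : IsTR ξ (m' + 2) B') (hB'' : IsTR ξ (m' + 2) B'')
    (e1 : f '' star ξ m H = top ξ m' B') (e2 : f '' top ξ m B = top ξ m' B'') : False := by
  obtain ⟨W, hW, hWB, hne⟩ := exists_ne_mem_star_top halt hnd hH hB hHX hXB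
  have e := eq_of_mem_top hB' hB'' (f.injective.ne hne) (e1 ▸ Set.mem_image_of_mem f hHX)
    (e1 ▸ Set.mem_image_of_mem f hW) (e2 ▸ Set.mem_image_of_mem f hXB)
    (e2 ▸ Set.mem_image_of_mem f hWB)
  refine star_ne_top halt hnd hm hH hB.1 (f.injective.image_injective ?_)
  change f '' _ = f '' _
  rw [e1, e2, e]

variable (hf : ∀ X Y, Adj ξ (m' + 1) (f X) (f Y) ↔ Adj ξ (m + 1) X Y)
include hf

theorem MapsTops.mapsStars (h2 : (2 : F) ≠ 0) (halt : ξ.IsAlt) (hnd : ξ.Nondegenerate)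
    (hm : m + 2 < finrank F V) (ht : MapsTops f) : MapsStars f := by
  intro H hH
  refine ((isBlock_star halt hnd hm hH).image h2 halt hnd hf).eq_star_or_eq_top.resolve_right ?_
  rintro ⟨B', hB', e⟩
  obtain ⟨X, hX⟩ := hH.exists_ge halt hnd (by omega)
  obtain ⟨B, hB⟩ := X.2.exists_ge halt hnd (by omega)
  obtain ⟨B'', hB'', e'⟩ := ht B.1 B.2
  exact not_image_top_top halt hnd hm hH B.2 hX hB hB' hB'' e e'

theorem MapsStars.mapsTops (h2 : (2 : F) ≠ 0) (halt : ξ.IsAlt) (hnd : ξ.Nondegenerate)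
    (hm1 : 1 ≤ m) (hm : m + 2 < finrank F V) (hs : MapsStars f) : MapsTops f := by
  intro B hB
  refine ((isBlock_top h2 halt hnd hm1 hB).image h2 halt hnd hf).eq_star_or_eq_top.resolve_left ?_
  rintro ⟨H', hH', e⟩
  obtain ⟨X, hX⟩ := hB.exists_le halt hnd
  obtain ⟨H, hH⟩ := X.2.exists_le halt hnd
  obtain ⟨H'', hH'', e'⟩ := hs H.1 H.2
  exact not_image_star_star halt hnd hm H.2 hB hH hX hH'' hH' e' e

theorem MapsTops.mapsStars_symm (h2 : (2 : F) ≠ 0) (halt : ξ.IsAlt) (hnd : ξ.Nondegenerate)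
    (hm' : m' + 2 < finrank F V) (ht : MapsTops f) : MapsStars f.symm := by
  intro H' hH'
  refine ((isBlock_star halt hnd hm' hH').image h2 halt hnd
    (adj_symm_iff hf)).eq_star_or_eq_top.resolve_right ?_
  rintro ⟨B, hB, e⟩
  obtain ⟨B', hB', e'⟩ := ht B hB
  refine star_ne_top halt hnd hm' hH' hB'.1 ?_
  rw [← e', ← e, f.image_symm_image]

/-- A star determines its centre, so `f` acts on centres. Preservation of tops serves the inverse:
it prevents `f.symm` from turning a star into a top. -/
theorem MapsStars.exists_equiv (h2 : (2 : F) ≠ 0) (halt : ξ.IsAlt) (hnd : ξ.Nondegenerate)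
    (hm : m + 2 < finrank F V) (hm' : m' + 2 < finrank F V)
    (hs : MapsStars f) (ht : MapsTops f) :
    ∃ h : TR ξ m ≃ TR ξ m', ∀ H X, (h H).1 ≤ (f X).1 ↔ H.1 ≤ X.1 := by
  have hs' := ht.mapsStars_symm hf h2 halt hnd hm'
  choose g hg eg using hs
  choose g' hg' eg' using hs'
  refine ⟨⟨fun H => ⟨g H.1 H.2, hg _ _⟩, fun H => ⟨g' H.1 H.2, hg' _ _⟩, fun H => ?_, fun H => ?_⟩,
    fun H X => ?_⟩
  · refine Subtype.ext (star_injective halt hnd hm (hg' _ _) H.2 ?_)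
    rw [← eg', ← eg, f.symm_image_image]
  · refine Subtype.ext (star_injective halt hnd hm' (hg _ _) H.2 ?_)
    rw [← eg, ← eg', f.image_symm_image]
  · change f X ∈ star ξ m' (g H.1 H.2) ↔ X ∈ star ξ m H.1
    rw [← eg, f.injective.mem_set_image]

end StarsTops

/-! ### Descent to points and the final dichotomy -/

section Descent

/-- The graph of points is not isomorphic to a graph on `(T-R)` of intermediate dimension. -/
theorem eq_zero_of_adj_one (h2 : (2 : F) ≠ 0) (halt : ξ.IsAlt) (hnd : ξ.Nondegenerate)
    (hm' : m' + 2 < finrank F V) (f : TR ξ (0 + 1) ≃ TR ξ (m' + 1))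
    (hf : ∀ X Y, Adj ξ (m' + 1) (f X) (f Y) ↔ Adj ξ (0 + 1) X Y) : m' = 0 := by
  by_contra h0
  -- Distinct points are always near, as they meet in the regular space `⊥`. Transported along `f`,
  -- this makes a star and a top both equal to the whole vertex set.
  have hnear : ∀ X Y : TR ξ (m' + 1), X ≠ Y → Near ξ m' X Y := by
    intro X Y hne
    rw [← near_map_iff h2 halt hnd f.symm (adj_symm_iff hf)]
    have hne' := f.symm.injective.ne hne
    have h3 := finrank_eq_zero.1 (Nat.le_zero.1 (TR.finrank_inf_le hne'))
    exact ⟨hne', Or.inl (h3 ▸ isTR_bot)⟩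
  obtain ⟨X, -⟩ := isTR_bot.exists_ge (ξ := ξ) halt hnd (by omega)
  obtain ⟨H, hH⟩ := (f X).2.exists_le halt hnd
  obtain ⟨B, hB⟩ := (f X).2.exists_ge halt hnd (by omega)
  refine star_ne_top halt hnd hm' H.2 B.2.1 ?_
  rw [Set.eq_univ_of_forall fun Z => (isBlock_star halt hnd hm' H.2).2.2 Z fun X _ => hnear Z X,
    Set.eq_univ_of_forall fun Z =>
      (isBlock_top h2 halt hnd (Nat.one_le_iff_ne_zero.2 h0) B.2).2.2 Z fun X _ => hnear Z X]

/-- An isomorphism of adjacency graphs taking tops to tops is induced by an automorphism of the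
lattice of subspaces which commutes with `⊥`. -/
theorem exists_orderIso_of_mapsTops (h2 : (2 : F) ≠ 0) (halt : ξ.IsAlt) (hnd : ξ.Nondegenerate)
    (m m' : ℕ) (hmm : Even m ↔ Even m') (hm : m + 2 < finrank F V) (hm' : m' + 2 < finrank F V)
    (f : TR ξ (m + 1) ≃ TR ξ (m' + 1))
    (hf : ∀ X Y, Adj ξ (m' + 1) (f X) (f Y) ↔ Adj ξ (m + 1) X Y) (ht : MapsTops f) :
    m = m' ∧ ∃ Φ : Submodule F V ≃o Submodule F V,
      (∀ U, Φ (ξ.orthogonal U) = ξ.orthogonal (Φ U)) ∧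
      ∀ U : TR ξ (m + 1), (f U).1 = Φ U.1 := by
  induction m generalizing m' with
  | zero =>
    obtain rfl := eq_zero_of_adj_one h2 halt hnd hm' f hf
    exact ⟨rfl, exists_orderIso_of_adj_one halt hnd hf⟩
  | succ l ih =>
    obtain _ | l' := m'
    · exact absurd (eq_zero_of_adj_one h2 halt hnd hm f.symm (adj_symm_iff hf)) (by omega)
    obtain ⟨h, hh⟩ := (ht.mapsStars hf h2 halt hnd hm).exists_equiv hf h2 halt hnd hm hm' ht
    have hll : Even l ↔ Even l' := by
      rw [Nat.even_add_one, Nat.even_add_one, not_iff_not] at hmm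
      exact hmm
    have hadj := adj_map_iff_of_incidence h2 halt hnd hll (by omega) (by omega) hh
    -- The bases of tops one level down are the vertices of the present level, so `h` takes the top
    -- of `B` to the top of `f B`.
    obtain ⟨rfl, Φ, hΦ, hh'⟩ := ih l' hll (by omega) (by omega) h hadj fun B hB => by
      refine ⟨(f ⟨B, hB⟩).1, (f ⟨B, hB⟩).2, Set.ext fun K => ?_⟩
      rw [h.image_eq_preimage_symm]
      change (h.symm K).1 ≤ (⟨B, hB⟩ : TR ξ (l + 2)).1 ↔ _
      rw [← hh, h.apply_symm_apply]
      rfl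
    refine ⟨rfl, Φ, hΦ, fun U => ?_⟩
    obtain ⟨H, hH⟩ := U.2.exists_le halt hnd
    obtain ⟨G, hG⟩ := H.2.exists_le halt hnd
    -- `U` is the join of two members one level down, on which `h` already agrees with `Φ`.
    obtain ⟨W, -, hWU, hne⟩ := exists_ne_mem_star_top halt hnd G.2 U.2 hG hH
    symm
    refine eq_of_le_of_finrank_eq ?_ (by rw [finrank_orderIso, U.finrank_eq, (f U).finrank_eq])
    rw [← TR.sup_eq hne U.2.1 hH hWU, Φ.map_sup, ← hh', ← hh']
    exact sup_le ((hh _ _).2 hH) ((hh _ _).2 hWU)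

theorem exists_orderIso_of_orthogonal_points (halt : ξ.IsAlt) (hnd : ξ.Nondegenerate)
    (h : (m + 1) + (0 + 1) = finrank F V) {f : Equiv.Perm (TR ξ (m + 1))}
    (hf : f ∈ adjacencyBijections ξ (m + 1)) :
    ∃ Φ : Submodule F V ≃o Submodule F V, (∀ U, Φ (ξ.orthogonal U) = ξ.orthogonal (Φ U)) ∧
      ∀ U : TR ξ (m + 1), (f U).1 = Φ U.1 := by
  let D := orthogonalEquiv halt hnd h
  have hD : ∀ X Y, Adj ξ 1 (D X) (D Y) ↔ Adj ξ (m + 1) X Y := fun X Y =>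
    adj_orthogonalEquiv halt hnd h
  obtain ⟨Φ, hΦ, hg⟩ := exists_orderIso_of_adj_one halt hnd (f := (D.symm.trans f).trans D)
    fun X Y => by
      change Adj ξ 1 (D (f (D.symm X))) (D (f (D.symm Y))) ↔ _
      rw [hD, hf, ← hD, D.apply_symm_apply, D.apply_symm_apply]
  refine ⟨Φ, hΦ, fun U => ?_⟩
  have h1 := hg (D U)
  rw [Equiv.trans_apply, Equiv.trans_apply, D.symm_apply_apply] at h1
  have h3 : ξ.orthogonal (f U).1 = Φ (ξ.orthogonal U.1) := h1
  rw [← orthogonal_orthogonal_eq halt hnd (f U).1, h3, hΦ, orthogonal_orthogonal_eq halt hnd]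

/-- A star and a top with a common member have images of different kinds. Two stars meeting a common
top thus have images of the same kind, and connectivity spreads this to all stars. -/
theorem mapsStars_or_image_top (h2 : (2 : F) ≠ 0) (halt : ξ.IsAlt) (hnd : ξ.Nondegenerate)
    (hm1 : 1 ≤ m) (hm : m + 2 < finrank F V) {f : TR ξ (m + 1) ≃ TR ξ (m' + 1)}
    (hf : ∀ X Y, Adj ξ (m' + 1) (f X) (f Y) ↔ Adj ξ (m + 1) X Y) :
    MapsStars f ∨ ∀ B, IsTR ξ (m + 2) B → ∃ H', IsTR ξ m' H' ∧ f '' top ξ m B = star ξ m' H' := by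
  have hstar := fun H hH =>
    ((isBlock_star (H := H) halt hnd hm hH).image h2 halt hnd hf).eq_star_or_eq_top
  have htop := fun B hB =>
    ((isBlock_top (B := B) h2 halt hnd hm1 hB).image h2 halt hnd hf).eq_star_or_eq_top
  by_cases hall : ∀ H : TR ξ m, ∃ H', IsTR ξ m' H' ∧ f '' star ξ m H.1 = star ξ m' H'
  · exact Or.inl fun H hH => hall ⟨H, hH⟩
  · right
    push Not at hall
    obtain ⟨H₀, hH₀⟩ := hall
    have hnone : ∀ H : TR ξ m, ¬ ∃ H', IsTR ξ m' H' ∧ f '' star ξ m H.1 = star ξ m' H' := by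
      intro H hP
      suffices hH₀' : ∃ H', IsTR ξ m' H' ∧ f '' star ξ m H₀.1 = star ξ m' H' by
        obtain ⟨H', hH', e⟩ := hH₀'
        exact hH₀ H' hH' e
      refine connected_of_common_ge halt hnd (by omega)
        (fun H : TR ξ m => ∃ H', IsTR ξ m' H' ∧ f '' star ξ m H.1 = star ξ m' H') ?_ H H₀ hP
      rintro K K' X hK hK' ⟨H', hH', e⟩
      refine (hstar K'.1 K'.2).resolve_right ?_
      rintro ⟨B', hB', e'⟩
      obtain ⟨B, hB⟩ := X.2.exists_ge halt hnd (by omega)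
      rcases htop B.1 B.2 with ⟨H'', hH'', e''⟩ | ⟨B'', hB'', e''⟩
      · exact not_image_star_star halt hnd hm K.2 B.2 hK hB hH' hH'' e e''
      · exact not_image_top_top halt hnd hm K'.2 B.2 hK' hB hB' hB'' e' e''
    intro B hB
    refine (htop B hB).resolve_right ?_
    rintro ⟨B', hB', e⟩
    obtain ⟨X, hX⟩ := hB.exists_le halt hnd
    obtain ⟨H, hH⟩ := X.2.exists_le halt hnd
    obtain ⟨B'', hB'', e'⟩ := (hstar H.1 H.2).resolve_left (hnone H)
    exact not_image_top_top halt hnd hm H.2 hB hH hX hB'' hB' e' e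

/-- Adjacency preserving bijections are induced by automorphisms of the polar geometry, up to the
duality in the middle dimension. -/
theorem adjacencyBijections_subset (h2 : (2 : F) ≠ 0) (halt : ξ.IsAlt) (hnd : ξ.Nondegenerate)
    (hm : m + 2 ≤ finrank F V) {f : Equiv.Perm (TR ξ (m + 1))}
    (hf : f ∈ adjacencyBijections ξ (m + 1)) :
    f ∈ inducedBijections ξ (m + 1) ∨
      (2 * (m + 1) = finrank F V ∧ f ∈ dualInducedBijections ξ (m + 1)) := by
  rcases hm.eq_or_lt with hm | hm
  · exact Or.inl ((mem_inducedBijections halt hnd).2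
      (exists_orderIso_of_orthogonal_points halt hnd hm hf))
  by_cases hm0 : m = 0
  · subst hm0
    exact Or.inl ((mem_inducedBijections halt hnd).2 (exists_orderIso_of_adj_one halt hnd hf))
  rcases mapsStars_or_image_top h2 halt hnd (by omega) hm hf with hs | ht
  · exact Or.inl ((mem_inducedBijections halt hnd).2 (exists_orderIso_of_mapsTops h2 halt hnd m m
      Iff.rfl hm hm f hf (hs.mapsTops hf h2 halt hnd (by omega) hm)).2)
  right
  obtain ⟨m', hm'⟩ : ∃ m', m + 1 + (m' + 1) = finrank F V := ⟨finrank F V - (m + 2), by omega⟩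
  let D := orthogonalEquiv halt hnd hm'
  have hmm : Even m ↔ Even m' := by
    have := even_finrank halt hnd
    rw [← hm', show m + 1 + (m' + 1) = m + m' + 2 by ring, Nat.even_add] at this
    exact Nat.even_add.1 (this.2 even_two)
  -- Followed by the duality, `f` takes tops to tops, but from level `m + 1` to level `m' + 1`; the
  -- resulting `m = m'` is what confines this case to the middle dimension.
  obtain ⟨e, Φ, hΦ, h⟩ := exists_orderIso_of_mapsTops h2 halt hnd m m' hmm hm (by omega)
    (f.trans D) (fun X Y => (adj_orthogonalEquiv halt hnd hm').trans (hf X Y)) fun B hB => by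
      obtain ⟨H', hH', e⟩ := ht B hB
      refine ⟨ξ.orthogonal H', (isTR_orthogonal halt hnd (by omega)).2 hH', ?_⟩
      rw [Equiv.coe_trans, Set.image_comp, e, ← preimage_top_orthogonal halt hnd hm',
        Set.image_preimage_eq _ D.surjective]
  refine ⟨by omega, _, preservesConj_orderIso hΦ, fun U => ?_⟩
  have h1 : ξ.orthogonal (f U).1 = Φ U.1 := h U
  rw [← orthogonal_orthogonal_eq halt hnd (f U).1, h1, ← hΦ]
  exact maps_orderIso Φ _

end Descent

end SymplecticGrassmann

theorem corollary3 {F V : Type*} [Field F] [AddCommGroup V] [Module F V]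
    [FiniteDimensional F V] (hF : ringChar F ≠ 2)
    (ξ : LinearMap.BilinForm F V) (halt : ξ.IsAlt) (hnd : ξ.Nondegenerate)
    (n k : ℕ) (hn : Module.finrank F V = n) (hk : 1 ≤ k) (hkn : k ≤ n - 1) :
    (k ≠ n - k →
      grassmannAutomorphisms ξ k = adjacencyBijections ξ k ∧
      adjacencyBijections ξ k = inducedBijections ξ k ∧
      (∀ φ : Collineation F V, φ.PreservesConj ξ →
        ∃! f : Equiv.Perm (TR ξ k), ∀ U : TR ξ k, φ.Maps U.1 (f U).1)) ∧
    (k = n - k →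
      adjacencyBijections ξ k ⊆ inducedBijections ξ k ∪ dualInducedBijections ξ k) := by
  obtain ⟨m, rfl⟩ : ∃ m, k = m + 1 := ⟨k - 1, by omega⟩
  have h2 : (2 : F) ≠ 0 := Ring.two_ne_zero hF
  have key := fun f => adjacencyBijections_subset (m := m) (f := f) h2 halt hnd (by omega)
  refine ⟨fun hne => ?_, fun _ f hf => (key f hf).imp_right And.right⟩
  have h1 : adjacencyBijections ξ (m + 1) ⊆ inducedBijections ξ (m + 1) := fun f hf =>
    (key f hf).resolve_right fun h => hne (by omega)
  have h3 := inducedBijections_subset halt hnd (m + 1)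
  have h4 := grassmannAutomorphisms_subset (ξ := ξ) (m + 1)
  exact ⟨h4.antisymm (h1.trans h3), h1.antisymm (h3.trans h4),
    fun φ hφ => existsUnique_induced halt hnd _ hφ⟩
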